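/- Let $d\in\{2,3\}$ and let $\Omega\subset\mathbb R^d$ be a bounded polygonal/polyhedral domain, with a finite conforming simplicial mesh $\mathcal T_h$ (closed nondegenerate $d$-simplices with union $\overline\Omega$, any two distinct ones meeting in a common, possibly empty, proper face, and $\partial\Omega$ contained in the union of the facets). Let $\mathcal E(K)$ be the set of the $d+1$ facets of $K\in\mathcal T_h$, $\mathcal E_h=\bigcup_K\mathcal E(K)$, and let $|K|$, $|F|$ denote the $d$-dimensional measure of $K$ and the $(d-1)$-dimensional measure of a facet $F$. Let $a>0$ be constant on every element and let $f\in L^2(\Omega)$. For integers $k\ge 1$, $m\ge 0$ put $$V_{h,k}=\{v\in L^2(\Omega): v|_K\in\mathbb P_k(K)\ \forall K\in\mathcal T_h\},$$ $$M^0_{h,m}=\{\widehat v\in L^2(\mathcal E_h): \widehat v|_F\in\mathbb P_m(F)\ \forall F\in\mathcal E_h,\ \widehat v|_F=0\ \text{ whenever } F\subset\partial\Omega\},$$ where $\mathbb P_m(D)$ denotes the polynomials of degree at most $m$ on $D$. Let $\delta\in\{0,1\}$ and, for $K\in\mathcal T_h$ and $F\in\mathcal E(K)$, let $P_M$ be the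 $L^2(F)$-orthogonal projection onto $\mathbb P_{k-\delta}(F)$, applied to traces from $K$. Let $\mathbf n$ be the outward unit normal on $\partial K$. Define the stabilization parameter (constant on each facet of each element) by $$\alpha_h|_F=\frac{a|_K\,\gamma}{|F|}\sum_{F'\in\mathcal E(K)}\frac{|F'|^2}{|K|}\qquad\text{for all } F\in\mathcal E(K),\ K\in\mathcal T_h,$$ and, writing $(\cdot,\cdot)_K$ and $\langle\cdot,\cdot\rangle_{\partial K}$ for the $L^2$ inner products on $K$ and on $\partial K$ (the latter being the sum of the integrals over the facets $F\in\mathcal E(K)$), set $$\mathcal B_h\big((u,\widehat u),(v,\widehat v)\big)=\sum_{K\in\mathcal T_h}\Big\{(a\nabla u,\nabla v)_K-\langle a\nabla u\cdot\mathbf n,v-\widehat v\rangle_{\partial K}-\langle a\nabla v\cdot\mathbf n,u-\widehat u\rangle_{\partial K}+\langle\alpha_h(P_Mu-\widehat u),P_Mv-\widehat v\rangle_{\partial K}\Big\}.$$ If the constant $\gamma$ satisfies $\gamma>\dfrac{k(k+d-1)}{d}$, then there is a unique $(u_h,\widehat u_h)\in V_{h,k}\times M^0_{h,k-\delta}$ such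 that $$\mathcal B_h\big((u_h,\widehat u_h),(v,\widehat v)\big)=\sum_{K\in\mathcal T_h}(f,v)_K\qquad\text{for all }(v,\widehat v)\in V_{h,k}\times M^0_{h,k-\delta}.$$ -/

import Mathlib

open MeasureTheory
open scoped NNReal ENNReal

namespace HDG

/-- The ambient Euclidean space `ℝ^d`. -/
abbrev Space (d : ℕ) : Type := EuclideanSpace ℝ (Fin d)

/-- The closed simplex spanned by a finite set of vertices. -/
abbrev hull {d : ℕ} (s : Finset (Space d)) : Set (Space d) :=
  convexHull ℝ (s : Set (Space d))

/-- The value of a polynomial at a point. -/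
noncomputable def polyEval {d : ℕ} (p : MvPolynomial (Fin d) ℝ) (x : Space d) : ℝ :=
  MvPolynomial.eval (fun i => x i) p

/-- The gradient of a polynomial at a point. -/
noncomputable def polyGrad {d : ℕ} (p : MvPolynomial (Fin d) ℝ) (x : Space d) : Space d :=
  WithLp.toLp 2 fun i => polyEval (MvPolynomial.pderiv i p) x

/-- The directional derivative `∇p · n` of a polynomial, again a polynomial. -/
noncomputable def polyDirDeriv {d : ℕ} (n : Space d) (p : MvPolynomial (Fin d) ℝ) :
    MvPolynomial (Fin d) ℝ :=
  ∑ i, n i • MvPolynomial.pderiv i p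

theorem polyEval_polyDirDeriv {d : ℕ} (n : Space d) (p : MvPolynomial (Fin d) ℝ) (x : Space d) :
    polyEval (polyDirDeriv n p) x = inner ℝ (polyGrad p x) n := by
  simp [polyEval, polyDirDeriv, polyGrad, PiLp.inner_apply, MvPolynomial.smul_eval]

theorem continuous_polyEval {d : ℕ} (p : MvPolynomial (Fin d) ℝ) :
    Continuous (polyEval p) := by
  unfold polyEval
  exact (MvPolynomial.continuous_eval p).comp (by fun_prop)

/-- A conforming simplicial mesh of a polygonal / polyhedral open set `Ω ⊆ ℝ^d`.
Every element is recorded by its set of `d + 1` vertices; the element itself is the closed simplex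
`hull K`. Two elements meet in the (possibly empty) common face spanned by their common vertices.
The last field says that the boundary of `Ω` is made up of (parts of) facets of elements. -/
structure Mesh (d : ℕ) (Ω : Set (Space d)) where
  cells : Finset (Finset (Space d))
  card_cell : ∀ K ∈ cells, K.card = d + 1
  affineIndependent : ∀ K ∈ cells, AffineIndependent ℝ ((↑) : K → Space d)
  conforming : ∀ K ∈ cells, ∀ K' ∈ cells,
    hull K ∩ hull K' = convexHull ℝ ((K : Set (Space d)) ∩ (K' : Set (Space d)))
  closure_eq : closure Ω = ⋃ K ∈ cells, hull K
  frontier_subset : frontier Ω ⊆ ⋃ K ∈ cells, ⋃ F ∈ K.powersetCard d, hull F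

namespace Mesh

variable {d : ℕ} {Ω : Set (Space d)}

/-- The elements `K ∈ 𝒯_h`. -/
abbrev Cell (T : Mesh d Ω) : Type := {K : Finset (Space d) // K ∈ T.cells}

open Classical in
/-- The vertex sets of all facets: the `d`-element subsets of the vertex sets of elements. -/
noncomputable def facets (T : Mesh d Ω) : Finset (Finset (Space d)) :=
  T.cells.biUnion fun K => K.powersetCard d

/-- The facets `F ∈ ℰ_h`. -/
abbrev Facet (T : Mesh d Ω) : Type := {F : Finset (Space d) // F ∈ T.facets}

open Classical in
/-- The set `ℰ(K)` of the facets of the element `K`. -/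
noncomputable def facetsOf (T : Mesh d Ω) (K : T.Cell) : Finset T.Facet :=
  Finset.univ.filter fun F => F.1 ⊆ K.1

/-- The facet `F` lies on `∂Ω`. -/
def IsBoundaryFacet (T : Mesh d Ω) (F : T.Facet) : Prop := hull F.1 ⊆ frontier Ω

/-- The measure `|K|` of an element. -/
noncomputable def cellVolume (T : Mesh d Ω) (K : T.Cell) : ℝ := (volume (hull K.1)).toReal

/-- The surface measure on the facet `F`: the `(d-1)`-dimensional Hausdorff measure, normalised to
agree with Lebesgue measure, restricted to `F`. -/
noncomputable def facetMeasure (T : Mesh d Ω) (F : T.Facet) : Measure (Space d) :=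
  (Measure.euclideanHausdorffMeasure (d - 1)).restrict (hull F.1)

/-- The measure `|F|` of a facet. -/
noncomputable def facetArea (T : Mesh d Ω) (F : T.Facet) : ℝ :=
  (T.facetMeasure F Set.univ).toReal

/-- The unit normal on the facet `F` of `K` pointing out of `K`: the normalised component,
orthogonal to `F`, of the vector from the centroid of `K` to the centroid of `F`. -/
noncomputable def outwardNormal (T : Mesh d Ω) (K : T.Cell) (F : T.Facet) : Space d :=
  NormedSpace.normalize
    ((vectorSpan ℝ (F.1 : Set (Space d)))ᗮ.starProjection
      (F.1.centroid ℝ id - K.1.centroid ℝ id))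

end Mesh

/-- A simplex with `n + 1` vertices has finite `n`-dimensional measure. -/
theorem euclideanHausdorffMeasure_hull_lt_top {d n : ℕ} (s : Finset (Space d))
    (hs : s.card = n + 1) :
    (Measure.euclideanHausdorffMeasure n : Measure (Space d)) (hull s) < ∞ := by
  let e : Fin (n + 1) ≃ s := (s.equivFinOfCardEq hs).symm
  let L : (Fin n → ℝ) →ₗ[ℝ] Space d :=
    ∑ i : Fin n, (LinearMap.proj i).smulRight ((e i.succ : Space d) - e 0)
  let Lc : (Fin n → ℝ) →L[ℝ] Space d := LinearMap.toContinuousLinearMap L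
  have hLip : LipschitzWith ‖Lc‖₊ (fun c => Lc c + (e 0 : Space d)) := by
    intro x y
    simpa using Lc.lipschitz x y
  have hsub : hull s ⊆ (fun c => Lc c + (e 0 : Space d)) '' Set.Icc 0 1 := by
    intro x hx
    rw [Finset.mem_convexHull'] at hx
    obtain ⟨w, hw0, hw1, hwx⟩ := hx
    have hsum (g : Space d → ℝ) : ∑ y ∈ s, g y = ∑ i, g (e i) := by
      rw [← Finset.sum_coe_sort s, ← e.sum_comp]
    have hsum' (g : Space d → Space d) : ∑ y ∈ s, g y = ∑ i, g (e i) := by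
      rw [← Finset.sum_coe_sort s, ← e.sum_comp]
    rw [hsum] at hw1
    rw [hsum'] at hwx
    have hnn : ∀ i, 0 ≤ w (e i) := fun i => hw0 _ (e i).2
    refine ⟨fun i => w (e i.succ), ⟨fun i => hnn _, fun i => ?_⟩, ?_⟩
    · have := Finset.single_le_sum (f := fun i => w (e i)) (fun i _ => hnn i)
        (Finset.mem_univ i.succ)
      simp only [Pi.one_apply]
      linarith
    · have h0 : w (e 0) = 1 - ∑ i : Fin n, w (e i.succ) := by
        rw [Fin.sum_univ_succ] at hw1; linarith
      rw [← hwx, Fin.sum_univ_succ, h0]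
      simp only [Lc, L, LinearMap.coe_toContinuousLinearMap', LinearMap.sum_apply,
        LinearMap.smulRight_apply, LinearMap.proj_apply, smul_sub, Finset.sum_sub_distrib,
        sub_smul, one_smul, Finset.sum_smul]
      abel
  have hfin : (Measure.hausdorffMeasure (n : ℝ) : Measure (Space d)) (hull s) < ∞ := by
    refine lt_of_le_of_lt (measure_mono hsub) ?_
    refine lt_of_le_of_lt (hLip.hausdorffMeasure_image_le (by positivity) _) ?_
    have := hausdorffMeasure_pi_real (ι := Fin n)
    simp only [Fintype.card_fin] at this
    rw [this]
    refine ENNReal.mul_lt_top (by simp) ?_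
    exact isCompact_Icc.measure_lt_top
  rw [Measure.euclideanHausdorffMeasure_def, Measure.smul_apply]
  exact ENNReal.mul_lt_top (by simp) hfin

namespace Mesh

variable {d : ℕ} {Ω : Set (Space d)}

theorem card_facet (T : Mesh d Ω) (F : T.Facet) : F.1.card = d := by
  obtain ⟨F, hF⟩ := F
  simp only [facets, Finset.mem_biUnion, Finset.mem_powersetCard] at hF
  obtain ⟨K, -, -, h⟩ := hF
  exact h

instance (T : Mesh d Ω) (F : T.Facet) : IsFiniteMeasure (T.facetMeasure F) := by
  refine ⟨?_⟩
  rw [facetMeasure, Measure.restrict_apply_univ]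
  have h := T.card_facet F
  rcases Nat.eq_zero_or_pos d with hd | hd
  · have : F.1 = ∅ := by rw [← Finset.card_eq_zero, h, hd]
    simp [hull, this]
  · exact euclideanHausdorffMeasure_hull_lt_top F.1 (by omega)

theorem isCompact_hull (s : Finset (Space d)) : IsCompact (hull s) :=
  s.finite_toSet.isCompact_convexHull ℝ

theorem memLp_polyEval (T : Mesh d Ω) (F : T.Facet) (p : MvPolynomial (Fin d) ℝ) :
    MemLp (polyEval p) 2 (T.facetMeasure F) := by
  obtain ⟨C, hC⟩ := (isCompact_hull F.1).exists_bound_of_continuousOn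
    (continuous_polyEval p).continuousOn
  refine MemLp.of_bound (continuous_polyEval p).aestronglyMeasurable C ?_
  exact (ae_restrict_mem (isCompact_hull F.1).isClosed.measurableSet).mono hC

/-- The space `L²(F)`. -/
abbrev FacetL2 (T : Mesh d Ω) (F : T.Facet) : Type := Lp ℝ 2 (T.facetMeasure F)

/-- The trace of a polynomial on the facet `F`, as an element of `L²(F)`. -/
noncomputable def trace (T : Mesh d Ω) (F : T.Facet) :
    MvPolynomial (Fin d) ℝ →ₗ[ℝ] T.FacetL2 F where
  toFun p := (T.memLp_polyEval F p).toLp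
  map_add' p q := by
    rw [← MemLp.toLp_add]
    exact MemLp.toLp_congr _ _ (Filter.Eventually.of_forall fun x => by simp [polyEval])
  map_smul' c p := by
    rw [RingHom.id_apply, ← MemLp.toLp_const_smul]
    exact MemLp.toLp_congr _ _ (Filter.Eventually.of_forall fun x => by
      simp [polyEval, MvPolynomial.smul_eval])

/-- The space `ℙ_m(F) ⊆ L²(F)` of polynomials of degree at most `m` on the facet `F`. -/
noncomputable def facetPoly (T : Mesh d Ω) (m : ℕ) (F : T.Facet) : Submodule ℝ (T.FacetL2 F) :=
  (MvPolynomial.restrictTotalDegree (Fin d) ℝ m).map (T.trace F)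

instance (T : Mesh d Ω) (m : ℕ) (F : T.Facet) : FiniteDimensional ℝ (T.facetPoly m F) := by
  unfold facetPoly
  infer_instance

/-- The `L²(F)`-orthogonal projection `P_M` onto `ℙ_m(F)`. -/
noncomputable def proj (T : Mesh d Ω) (m : ℕ) (F : T.Facet) : T.FacetL2 F →L[ℝ] T.FacetL2 F :=
  (T.facetPoly m F).starProjection

/-- The space `V_{h,k}` of piecewise polynomials: one polynomial of degree at most `k` for every
element (elements have nonempty interior, so polynomials and polynomial functions on them are the
same thing). -/
noncomputable def V (T : Mesh d Ω) (k : ℕ) : Submodule ℝ (T.Cell → MvPolynomial (Fin d) ℝ) :=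
  Submodule.pi Set.univ fun _ => MvPolynomial.restrictTotalDegree (Fin d) ℝ k

/-- The space `M_{h,m}` of functions in `L²(ℰ_h)` that are polynomials of degree at most `m` on
every facet. -/
noncomputable def M (T : Mesh d Ω) (m : ℕ) : Submodule ℝ ((F : T.Facet) → T.FacetL2 F) :=
  Submodule.pi Set.univ fun F => T.facetPoly m F

/-- The subspace `M⁰_{h,m}` of the functions in `M_{h,m}` that vanish on all boundary facets. -/
noncomputable def M0 (T : Mesh d Ω) (m : ℕ) : Submodule ℝ ((F : T.Facet) → T.FacetL2 F) :=
  T.M m ⊓ Submodule.pi {F | T.IsBoundaryFacet F} fun _ => ⊥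

/-- The stabilization parameter
`α_h|_F = (a|_K γ / |F|) ∑_{F' ∈ ℰ(K)} |F'|² / |K|` on the facet `F` of the element `K`. -/
noncomputable def stabPrimal (T : Mesh d Ω) (a : T.Cell → ℝ) (γ : ℝ) (K : T.Cell) (F : T.Facet) :
    ℝ :=
  a K * γ / T.facetArea F * ∑ F' ∈ T.facetsOf K, T.facetArea F' ^ 2 / T.cellVolume K

/-- The primal HDG bilinear form on `V_{h,k} × M⁰_{h,m}`, with coefficient `a` (one value on every
element) and stabilization parameter `α` (one value for every facet of every element). -/
noncomputable def primalForm (T : Mesh d Ω) (a : T.Cell → ℝ) (α : T.Cell → T.Facet → ℝ)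
    {k m : ℕ} (u v : T.V k × T.M0 m) : ℝ :=
  ∑ K : T.Cell,
    ((∫ x in hull K.1, a K * inner ℝ (polyGrad (u.1.1 K) x) (polyGrad (v.1.1 K) x))
      - ∑ F ∈ T.facetsOf K,
          inner ℝ (a K • T.trace F (polyDirDeriv (T.outwardNormal K F) (u.1.1 K)))
            (T.trace F (v.1.1 K) - v.2.1 F)
      - ∑ F ∈ T.facetsOf K,
          inner ℝ (a K • T.trace F (polyDirDeriv (T.outwardNormal K F) (v.1.1 K)))
            (T.trace F (u.1.1 K) - u.2.1 F)
      + ∑ F ∈ T.facetsOf K,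
          inner ℝ (α K F • (T.proj m F (T.trace F (u.1.1 K)) - u.2.1 F))
            (T.proj m F (T.trace F (v.1.1 K)) - v.2.1 F))

/-- The linear form `∑_K (f, v)_K`. -/
noncomputable def primalLoad (T : Mesh d Ω) (f : Space d → ℝ) {k m : ℕ} (v : T.V k × T.M0 m) : ℝ :=
  ∑ K : T.Cell, ∫ x in hull K.1, f x * polyEval (v.1.1 K) x

end Mesh

end HDG

/-!
The discrete problem is a square linear system, so it suffices that the bilinear form is definite:
`B (u, u) = 0` forces `u = 0`.

The threshold on `γ` comes from a sharp trace inequality for polynomials `q` of degree at most `j` on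
a facet `F` of a `d`-simplex `K`,
`‖q‖²_F ≤ (j + 1) (j + d) / d * |F| / |K| * ‖q‖²_K` (`HDG.sharp_trace_inequality`). Seen from the
vertex `p` opposite to `F`, the simplex is a cone over `F`, so that `∫_K q²` is a multiple of the
integral over `z ∈ F` of `∫₀¹ t ^ (d - 1) * q (p + t (z - p))² dt`
(`HDG.setIntegral_coneOver`). On every ray the inequality is the one-dimensional statement
`g(1)² ≤ (j + 1) (j + d) ∫₀¹ t ^ (d - 1) g²` (`HDG.sq_eval_one_le`), which is Cauchy–Schwarz against
the polynomial representing evaluation at `1`; the coefficients of that polynomial are residues of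
an explicit rational function (`HDG.exists_endpoint_kernel`). The factor `1 / d` and the areas
appear by normalising with `q = 1`, so no volume formula for simplices is needed.

With `j = k - 1`, applied to normal derivatives, and with `α_h` as in the problem, the areas cancel
when the facets of an element are summed. Since normal derivatives lie in the range of `P_M`, they
only see the projected jump, and Young's inequality bounds the form on each element below by a
positive multiple of the gradient energy plus a positive multiple of the projected jumps
(`HDG.element_form_coercive`).

If the form vanishes, `u_h` is therefore constant on every element and equal to the single-valued
`û_h` on its facets. It remains to see that every element is linked through common facets to a
boundary facet (`HDG.Mesh.not_of_facet_neighbours`): a line in general position through the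
elements with a nonzero value misses all faces of codimension two, so its last point in these
elements is in the relative interior of a facet. If there were an element on the other side of that
facet, it would have the same value and the line would go on in it; hence the facet lies on the
boundary, where `û_h` vanishes.
-/

namespace HDG

/-! ### A sharp one-dimensional endpoint inequality -/

open Polynomial in
/-- Coefficients of the polynomial representing evaluation at `1` on polynomials of degree at most
`j` with respect to the weight `t ^ n` on `[0, 1]`. They are the residues of the partial fraction
expansion of `1 - ∏ (x - i) / ∏ (x + l + n + 1)`. -/
theorem exists_endpoint_kernel (n j : ℕ) : ∃ c : ℕ → ℝ,
    (∀ i ∈ Finset.range (j + 1), ∑ l ∈ Finset.range (j + 1), c l / (i + l + n + 1) = 1) ∧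
    ∑ l ∈ Finset.range (j + 1), c l = (j + 1) * (j + n + 1) := by
  classical
  set s := Finset.range (j + 1) with hs
  set v : ℕ → ℝ := fun l => -(l + n + 1) with hv
  have hvs : Set.InjOn v s := by
    intro a _ b _ h
    simp only [hv, neg_inj, add_left_inj, Nat.cast_inj] at h
    exact h
  set D : ℝ[X] := Lagrange.nodal s v with hD
  set Q : ℝ[X] := Lagrange.nodal s (fun i : ℕ => (i : ℝ)) with hQ
  set N : ℝ[X] := D - Q with hN
  have hcard : s.card = j + 1 := Finset.card_range _
  have hNdeg : N.degree < s.card := by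
    have := degree_sub_lt_left (p := D) (q := Q) (by rw [hD, hQ, Lagrange.degree_nodal,
      Lagrange.degree_nodal]) (Lagrange.nodal_ne_zero) (by
        rw [(Lagrange.nodal_monic (s := s) (v := v)).leadingCoeff,
          (Lagrange.nodal_monic (s := s) (v := fun i : ℕ => (i : ℝ))).leadingCoeff])
    rwa [hD, Lagrange.degree_nodal] at this
  refine ⟨fun l => Lagrange.nodalWeight s v l * N.eval (v l), fun i hi => ?_, ?_⟩
  · have hne : ∀ l ∈ s, (i : ℝ) ≠ v l := by
      intro l _ h
      have : (0 : ℝ) < i + l + n + 1 := by positivity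
      simp only [hv] at h
      linarith
    have h1 := Lagrange.eval_interpolate_not_at_node (r := fun l => N.eval (v l)) hne
    rw [← Lagrange.eq_interpolate hvs hNdeg] at h1
    have h2 : N.eval (i : ℝ) = D.eval (i : ℝ) := by
      rw [hN, eval_sub, hQ, Lagrange.eval_nodal_at_node hi, sub_zero]
    have h3 : D.eval (i : ℝ) ≠ 0 := Lagrange.eval_nodal_not_at_node hne
    rw [h2] at h1
    have h4 := mul_left_cancel₀ h3 (h1.symm.trans (mul_one _).symm)
    refine Eq.trans (Finset.sum_congr rfl fun l _ => ?_) h4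
    have : (i : ℝ) - v l = i + l + n + 1 := by simp only [hv]; ring
    rw [this]
    ring
  · have hcoeff := Lagrange.coeff_eq_sum (P := N) hvs (by rw [hcard] at hNdeg ⊢; exact hNdeg)
    have hpred (u : ℕ → ℝ) : (Lagrange.nodal s u).coeff j = -∑ i ∈ s, u i := by
      have := prod_X_sub_C_coeff_card_pred s u (by rw [hcard]; omega)
      rwa [hcard, Nat.add_sub_cancel] at this
    -- the subleading coefficients of the two monic products
    have hNj : N.coeff j = (j + 1) * (j + n + 1) := by
      rw [hN, coeff_sub, hD, hQ, hpred, hpred, ← Finset.sum_neg_distrib]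
      simp only [hv, neg_neg, sub_neg_eq_add]
      rw [← Finset.sum_add_distrib]
      have key : ∀ m : ℕ, ∑ x ∈ Finset.range m, (((x : ℝ) + n + 1) + x) = m * (m + n) := by
        intro m
        induction m with
        | zero => simp
        | succ m ih => rw [Finset.sum_range_succ, ih]; push_cast; ring
      rw [hs, key]
      push_cast
      ring
    rw [hcard, Nat.add_sub_cancel] at hcoeff
    rw [← hNj, hcoeff]
    refine Finset.sum_congr rfl fun l _ => ?_
    simp only [Lagrange.nodalWeight, Finset.prod_inv_distrib]
    ring

open Polynomial in
/-- Sharp endpoint inequality for the weight `t ^ n` on `[0, 1]`: Cauchy–Schwarz against the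
polynomial `R` representing evaluation at `1`, for which `∫ t ^ n R² = R(1) = (j + 1) (j + n + 1)`. -/
theorem sq_eval_one_le (n j : ℕ) (g : ℝ[X]) (hg : g.natDegree ≤ j) :
    g.eval 1 ^ 2 ≤ (j + 1) * (j + n + 1) * ∫ t in (0 : ℝ)..1, t ^ n * g.eval t ^ 2 := by
  obtain ⟨c, hc, hcs⟩ := exists_endpoint_kernel n j
  set s := Finset.range (j + 1) with hs
  set R : ℝ[X] := ∑ l ∈ s, C (c l) * X ^ l with hR
  have hRdeg : R.natDegree ≤ j := by
    refine natDegree_sum_le_of_forall_le _ _ fun l hl => ?_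
    refine (natDegree_C_mul_X_pow_le _ _).trans ?_
    have := Finset.mem_range.1 hl
    omega
  -- `R` represents evaluation at `1`
  have hrep (h : ℝ[X]) (hh : h.natDegree ≤ j) :
      ∫ t in (0 : ℝ)..1, t ^ n * (R * h).eval t = h.eval 1 := by
    have hh' : h = ∑ i ∈ s, C (h.coeff i) * X ^ i := h.as_sum_range_C_mul_X_pow' (by omega)
    have e : ∀ t : ℝ, t ^ n * (R * h).eval t =
        ∑ i ∈ s, ∑ l ∈ s, h.coeff i * c l * t ^ (i + l + n) := by
      intro t
      conv_lhs => rw [hh']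
      simp only [hR, eval_mul, eval_finsetSum, eval_C, eval_pow, eval_X]
      rw [Finset.sum_mul_sum, Finset.sum_comm, Finset.mul_sum]
      refine Finset.sum_congr rfl fun i _ => ?_
      rw [Finset.mul_sum]
      refine Finset.sum_congr rfl fun l _ => ?_
      ring
    simp_rw [e]
    rw [intervalIntegral.integral_finsetSum (fun i _ => Continuous.intervalIntegrable
      (by fun_prop) _ _)]
    conv_rhs => rw [hh', eval_finsetSum]
    refine Finset.sum_congr rfl fun i hi => ?_
    rw [intervalIntegral.integral_finsetSum (fun i _ => Continuous.intervalIntegrable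
      (by fun_prop) _ _)]
    simp only [intervalIntegral.integral_const_mul, integral_pow, eval_mul, eval_C, eval_pow,
      eval_X, one_pow, mul_one]
    refine Eq.trans ?_ ((congrArg (h.coeff i * ·) (hc i hi)).trans (mul_one _))
    rw [Finset.mul_sum]
    refine Finset.sum_congr rfl fun l _ => ?_
    push_cast
    rw [zero_pow (by omega)]
    ring
  have hR1 : R.eval 1 = (j + 1) * (j + n + 1) := by
    rw [hR, eval_finsetSum, ← hcs]
    simp
  set lam : ℝ := (j + 1) * (j + n + 1) with hlam
  have hlam0 : 0 < lam := by positivity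
  set I := ∫ t in (0 : ℝ)..1, t ^ n * g.eval t ^ 2 with hI
  -- the square that proves Cauchy–Schwarz for `g` and `R`
  have hnn : 0 ≤ ∫ t in (0 : ℝ)..1, t ^ n * (lam * g.eval t - g.eval 1 * R.eval t) ^ 2 :=
    intervalIntegral.integral_nonneg zero_le_one fun t ht =>
      mul_nonneg (pow_nonneg ht.1 _) (sq_nonneg _)
  have hexp : ∫ t in (0 : ℝ)..1, t ^ n * (lam * g.eval t - g.eval 1 * R.eval t) ^ 2 =
      lam ^ 2 * I - 2 * lam * g.eval 1 * g.eval 1 + g.eval 1 ^ 2 * lam := by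
    have e : ∀ t : ℝ, t ^ n * (lam * g.eval t - g.eval 1 * R.eval t) ^ 2 =
        lam ^ 2 * (t ^ n * g.eval t ^ 2) - 2 * lam * g.eval 1 * (t ^ n * (R * g).eval t) +
          g.eval 1 ^ 2 * (t ^ n * (R * R).eval t) := by
      intro t
      simp only [eval_mul]
      ring
    simp_rw [e]
    rw [intervalIntegral.integral_add, intervalIntegral.integral_sub,
      intervalIntegral.integral_const_mul, intervalIntegral.integral_const_mul,
      intervalIntegral.integral_const_mul, hrep g hg, hrep R hRdeg, hR1]
    all_goals exact Continuous.intervalIntegrable (by fun_prop) _ _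
  rw [hexp] at hnn
  have : 0 ≤ lam * (lam * I - g.eval 1 ^ 2) := by nlinarith
  have := nonneg_of_mul_nonneg_right this hlam0
  linarith

/-! ### Integration over cones -/

/-- The cone over `S`, with apex at the origin and with `S` placed at height `1`. -/
def coneOver {W : Type*} [SMul ℝ W] (S : Set W) : Set (ℝ × W) :=
  (fun p : ℝ × W => (p.1, p.1 • p.2)) '' (Set.Icc 0 1 ×ˢ S)

theorem isCompact_coneOver {W : Type*} [NormedAddCommGroup W] [NormedSpace ℝ W] {S : Set W}
    (hS : IsCompact S) : IsCompact (coneOver S) :=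
  (isCompact_Icc.prod hS).image (by fun_prop)

/-- Integration over a cone by radial slices: scaling the slice at height `t` back to the base
produces the weight `t ^ n`, where `n` is the dimension of the slices. -/
theorem setIntegral_coneOver {W : Type*} [NormedAddCommGroup W] [NormedSpace ℝ W]
    [FiniteDimensional ℝ W] [MeasurableSpace W] [BorelSpace W] (μ : Measure W)
    [μ.IsAddHaarMeasure] {S : Set W} (hS : IsCompact S) {G : ℝ × W → ℝ} (hG : Continuous G) :
    IntegrableOn (fun z => ∫ t in (0 : ℝ)..1, t ^ Module.finrank ℝ W * G (t, t • z)) S μ ∧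
    ∫ p in coneOver S, G p ∂((volume : Measure ℝ).prod μ) =
      ∫ z in S, (∫ t in (0 : ℝ)..1, t ^ Module.finrank ℝ W * G (t, t • z)) ∂μ := by
  set n := Module.finrank ℝ W with hn
  have hC := isCompact_coneOver hS
  have hSm : MeasurableSet S := hS.measurableSet
  have hintC : Integrable ((coneOver S).indicator G) ((volume : Measure ℝ).prod μ) :=
    (integrable_indicator_iff hC.measurableSet).2 (hG.continuousOn.integrableOn_compact hC)
  have hslice : ∀ t ∈ Set.Ioc (0 : ℝ) 1, ∫ y, (coneOver S).indicator G (t, y) ∂μ =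
      ∫ z in S, t ^ n * G (t, t • z) ∂μ := by
    intro t ht
    have e : ∀ z, (coneOver S).indicator G (t, t • z) = S.indicator (fun z => G (t, t • z)) z := by
      intro z
      have hiff : (t, t • z) ∈ coneOver S ↔ z ∈ S := by
        constructor
        · rintro ⟨⟨t', z'⟩, ⟨-, hz'⟩, h⟩
          simp only [Prod.mk.injEq] at h
          obtain ⟨rfl, h⟩ := h
          rwa [← smul_right_injective W ht.1.ne' h]
        · intro hz
          exact ⟨(t, z), ⟨⟨ht.1.le, ht.2⟩, hz⟩, rfl⟩
      by_cases hz : z ∈ S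
      · rw [Set.indicator_of_mem hz, Set.indicator_of_mem (hiff.2 hz)]
      · rw [Set.indicator_of_notMem hz, Set.indicator_of_notMem (fun h => hz (hiff.1 h))]
    have h1 := Measure.integral_comp_smul μ (fun y => (coneOver S).indicator G (t, y)) t
    simp only [e] at h1
    rw [integral_indicator hSm, abs_of_pos (inv_pos.2 (pow_pos ht.1 _)), smul_eq_mul,
      ← hn] at h1
    rw [integral_const_mul, h1, ← mul_assoc, mul_inv_cancel₀ (pow_pos ht.1 _).ne', one_mul]
  have hprod : Integrable (fun p : ℝ × W => p.1 ^ n * G (p.1, p.1 • p.2))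
      (((volume : Measure ℝ).restrict (Set.Ioc 0 1)).prod (μ.restrict S)) := by
    rw [Measure.prod_restrict]
    have : Continuous fun p : ℝ × W => p.1 ^ n * G (p.1, p.1 • p.2) := by fun_prop
    exact (this.continuousOn.integrableOn_compact (isCompact_Icc.prod hS)).mono_set
      (Set.prod_mono Set.Ioc_subset_Icc_self subset_rfl)
  simp only [intervalIntegral.integral_of_le zero_le_one]
  refine ⟨hprod.swap.integral_prod_left, ?_⟩
  rw [← integral_indicator hC.measurableSet, integral_prod _ hintC,
    ← setIntegral_eq_integral_of_ae_compl_eq_zero (s := Set.Ioc (0 : ℝ) 1),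
    setIntegral_congr_fun measurableSet_Ioc hslice]
  · exact integral_integral_swap (f := fun t z => t ^ n * G (t, t • z)) hprod
  · have h0 : ∀ᵐ t : ℝ, t ≠ 0 := by
      simp [ae_iff]
    filter_upwards [h0] with t ht0 ht
    refine integral_eq_zero_of_ae (Filter.Eventually.of_forall fun y => ?_)
    refine Set.indicator_of_notMem ?_ _
    rintro ⟨⟨t', z'⟩, ⟨ht', -⟩, h⟩
    simp only [Prod.mk.injEq] at h
    obtain ⟨rfl, -⟩ := h
    exact ht ⟨lt_of_le_of_ne ht'.1 ht0.symm, ht'.2⟩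

/-! ### The sharp trace inequality on a simplex -/

variable {d : ℕ}

/-- The vertices of a nondegenerate `d`-simplex, as an affine basis of the ambient space. -/
noncomputable def simplexBasis (K : Finset (Space d)) (hcard : K.card = d + 1)
    (hind : AffineIndependent ℝ ((↑) : K → Space d)) : AffineBasis K ℝ (Space d) :=
  ⟨(↑), hind, hind.affineSpan_eq_top_iff_card_eq_finrank_add_one.2 (by simp [hcard])⟩

@[simp]
theorem simplexBasis_apply (K : Finset (Space d)) (hcard : K.card = d + 1)
    (hind : AffineIndependent ℝ ((↑) : K → Space d)) (i : K) :
    simplexBasis K hcard hind i = i := rfl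

theorem range_simplexBasis (K : Finset (Space d)) (hcard : K.card = d + 1)
    (hind : AffineIndependent ℝ ((↑) : K → Space d)) :
    Set.range (simplexBasis K hcard hind) = K :=
  Subtype.range_coe

theorem hull_eq_coord_nonneg (K : Finset (Space d)) (hcard : K.card = d + 1)
    (hind : AffineIndependent ℝ ((↑) : K → Space d)) :
    hull K = {x | ∀ i, 0 ≤ (simplexBasis K hcard hind).coord i x} := by
  rw [← AffineBasis.convexHull_eq_nonneg_coord, range_simplexBasis]

theorem interior_hull_eq_coord_pos (K : Finset (Space d)) (hcard : K.card = d + 1)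
    (hind : AffineIndependent ℝ ((↑) : K → Space d)) :
    interior (hull K) = {x | ∀ i, 0 < (simplexBasis K hcard hind).coord i x} := by
  rw [← AffineBasis.interior_convexHull, range_simplexBasis]

theorem notMem_affineSpan_of_notMem {K F : Finset (Space d)}
    (hind : AffineIndependent ℝ ((↑) : K → Space d)) (hFK : F ⊆ K) {p : Space d} (hp : p ∈ K)
    (hpF : p ∉ F) : p ∉ affineSpan ℝ (F : Set (Space d)) := by
  have himg : ((↑) : K → Space d) '' {x | (x : Space d) ∈ F} = F := by
    ext z
    simpa using fun hz => hFK hz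
  have h := hind.mem_affineSpan_iff ⟨p, hp⟩ {x | (x : Space d) ∈ F}
  rw [himg] at h
  exact fun hpA => hpF (h.1 hpA)

theorem interior_hull_nonempty (K : Finset (Space d)) (hcard : K.card = d + 1)
    (hind : AffineIndependent ℝ ((↑) : K → Space d)) : (interior (hull K)).Nonempty := by
  rw [interior_convexHull_nonempty_iff_affineSpan_eq_top, ← range_simplexBasis K hcard hind]
  exact (simplexBasis K hcard hind).tot

theorem measureReal_hull_pos (K : Finset (Space d)) (hcard : K.card = d + 1)
    (hind : AffineIndependent ℝ ((↑) : K → Space d)) : 0 < volume.real (hull K) := by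
  refine ENNReal.toReal_pos ?_ (Mesh.isCompact_hull K).measure_lt_top.ne
  exact (Measure.measure_pos_of_nonempty_interior _ (interior_hull_nonempty K hcard hind)).ne'

open Polynomial in
/-- The restriction of a polynomial to a line, evaluated along the line, is a polynomial in one
variable of no larger degree. -/
theorem exists_polynomial_on_line (q : MvPolynomial (Fin d) ℝ) (p w : Space d) :
    ∃ g : ℝ[X], g.natDegree ≤ q.totalDegree ∧ ∀ t : ℝ, g.eval t = polyEval q (p + t • w) := by
  refine ⟨MvPolynomial.aeval (fun i => C (w i) * X + C (p i)) q, ?_, fun t => ?_⟩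
  · have := MvPolynomial.aeval_natDegree_le q le_rfl (fun i => C (w i) * X + C (p i)) (n := 1)
      fun i => natDegree_linear_le
    simpa using this
  · rw [← coe_evalRingHom, MvPolynomial.map_aeval]
    simp only [polyEval, coe_evalRingHom]
    rw [MvPolynomial.eval]
    congr 2
    · ext; simp
    · ext i; simp; ring

/-- The sharp trace inequality on a facet `F` of a simplex `K`. Seen from the vertex opposite to
`F`, the simplex is a cone over `F`, and the inequality is the integral over `F` of the
one-dimensional endpoint inequality on the segments of the cone. -/
theorem sharp_trace_inequality (hd : 1 ≤ d) (K F : Finset (Space d)) (hcard : K.card = d + 1)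
    (hind : AffineIndependent ℝ ((↑) : K → Space d)) (hFK : F ⊆ K) (hF : F.card = d) :
    0 < ((Measure.euclideanHausdorffMeasure (d - 1)).restrict (hull F) : Measure (Space d)).real
      Set.univ ∧
    ∀ (j : ℕ) (q : MvPolynomial (Fin d) ℝ), q.totalDegree ≤ j →
      (∫ x, polyEval q x ^ 2 ∂((Measure.euclideanHausdorffMeasure (d - 1)).restrict (hull F))) *
        volume.real (hull K) ≤
      (j + 1) * (j + d) / d *
        ((Measure.euclideanHausdorffMeasure (d - 1)).restrict (hull F) : Measure (Space d)).real
          Set.univ * ∫ x in hull K, polyEval q x ^ 2 := by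
  classical
  obtain ⟨p, hpF, rfl⟩ : ∃ p, p ∉ F ∧ insert p F = K := by
    obtain ⟨p, hpK, hpF⟩ := Finset.exists_mem_notMem_of_card_lt_card (show F.card < K.card by omega)
    refine ⟨p, hpF, Finset.eq_of_subset_of_card_le (Finset.insert_subset hpK hFK) ?_⟩
    rw [Finset.card_insert_of_notMem hpF]; omega
  obtain ⟨f₀, hf₀⟩ : F.Nonempty := Finset.card_pos.1 (by omega)
  have hf₀' : f₀ ∈ (F : Set (Space d)) := hf₀
  set W : Submodule ℝ (Space d) := vectorSpan ℝ (F : Set (Space d)) with hW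
  set w : Space d := f₀ - p with hw
  have hWrank : Module.finrank ℝ W = d - 1 := by
    have h1 : AffineIndependent ℝ ((↑) : F → Space d) :=
      hind.mono (by simp)
    have := h1.finrank_vectorSpan (n := d - 1) (by simp [hF]; omega)
    rw [Subtype.range_coe_subtype] at this
    exact this
  have hmem : ∀ z, z ∈ affineSpan ℝ (F : Set (Space d)) ↔ z - f₀ ∈ W := fun z => by
    rw [← AffineSubspace.vsub_right_mem_direction_iff_mem (mem_affineSpan ℝ hf₀') z,
      direction_affineSpan, vsub_eq_sub]
  have hwW : w ∉ W := by
    intro h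
    refine notMem_affineSpan_of_notMem hind hFK (Finset.mem_insert_self p F) hpF ?_
    rw [hmem, ← neg_sub]
    exact W.neg_mem h
  -- linear coordinates: height over the apex and position parallel to `F`
  set L : (ℝ × W) →ₗ[ℝ] Space d := (LinearMap.toSpanSingleton ℝ _ w).coprod W.subtype with hL
  have hLapp : ∀ t (y : W), L (t, y) = t • w + y := fun t y => by simp [hL]
  have hLinj : Function.Injective L := by
    rw [← LinearMap.ker_eq_bot, LinearMap.ker_eq_bot']
    rintro ⟨t, y⟩ h
    rw [hLapp] at h
    have ht : t = 0 := by
      by_contra ht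
      apply hwW
      have : w = t⁻¹ • (-(y : Space d)) := by
        rw [← eq_neg_of_add_eq_zero_left h, smul_smul, inv_mul_cancel₀ ht, one_smul]
      rw [this]
      exact W.smul_mem _ (W.neg_mem y.2)
    subst ht
    simpa using h
  let Le : (ℝ × W) ≃L[ℝ] Space d :=
    (LinearEquiv.ofInjectiveOfFinrankEq L hLinj (by
      rw [Module.finrank_prod, hWrank]; simp; omega)).toContinuousLinearEquiv
  have hLe : ∀ t (y : W), Le (t, y) = t • w + y := hLapp
  set φ : (ℝ × W) ≃ₜ Space d := Le.toHomeomorph.trans (Homeomorph.addLeft p) with hφdef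
  have hφ : ∀ t (y : W), φ (t, y) = p + (t • w + y) := fun t y => by
    rw [← hLe]; rfl
  set S : Set W := {y | f₀ + (y : Space d) ∈ hull F} with hS
  have hiso : Isometry fun y : W => f₀ + (y : Space d) :=
    (IsometryEquiv.addLeft f₀).isometry.comp isometry_subtype_coe
  have hSc : IsCompact S :=
    hiso.isClosedEmbedding.isCompact_preimage (Mesh.isCompact_hull F)
  have hspan : hull F ⊆ Set.range fun y : W => f₀ + (y : Space d) := by
    intro z hz
    have := convexHull_subset_affineSpan _ hz
    rw [SetLike.mem_coe, hmem] at this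
    exact ⟨⟨z - f₀, this⟩, by simp⟩
  have hKimg : hull (insert p F) = φ '' coneOver S := by
    have : hull (insert p F) = convexJoin ℝ {p} (hull F) := by
      rw [hull, Finset.coe_insert, convexHull_insert ⟨f₀, hf₀'⟩]
    rw [this, convexJoin_singleton_left]
    ext x
    simp only [Set.mem_iUnion, coneOver, Set.mem_image, Set.mem_prod, exists_prop]
    constructor
    · rintro ⟨z, hz, hx⟩
      obtain ⟨y, rfl⟩ := hspan hz
      rw [segment_eq_image'] at hx
      obtain ⟨t, ht, rfl⟩ := hx
      refine ⟨_, ⟨(t, y), ⟨ht, hz⟩, rfl⟩, ?_⟩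
      rw [hφ]
      simp only [hw, Submodule.coe_smul]
      module
    · rintro ⟨_, ⟨⟨t, y⟩, ⟨ht, hy⟩, rfl⟩, rfl⟩
      refine ⟨f₀ + y, hy, ?_⟩
      rw [segment_eq_image']
      refine ⟨t, ht, ?_⟩
      rw [hφ]
      simp only [hw, Submodule.coe_smul]
      module
  -- the surface measure on `F` is Lebesgue measure on `W`
  have hμF : (Measure.euclideanHausdorffMeasure (d - 1)).restrict (hull F) =
      ((volume : Measure W).restrict S).map fun y : W => f₀ + (y : Space d) := by
    have h1 := hiso.map_euclideanHausdorffMeasure (d := Module.finrank ℝ W)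
    rw [InnerProductSpace.euclideanHausdorffMeasure_eq_volume, hWrank] at h1
    have h2 := congrArg (fun m => Measure.restrict m (hull F)) h1
    simp only at h2
    rw [Measure.restrict_restrict (Mesh.isCompact_hull F).measurableSet,
      Set.inter_eq_left.2 hspan, hiso.isClosedEmbedding.measurableEmbedding.restrict_map] at h2
    exact h2.symm
  have hembF := hiso.isClosedEmbedding.measurableEmbedding
  -- Lebesgue measure in the coordinates `φ`
  obtain ⟨c, hc⟩ : ∃ c : ℝ≥0, (volume : Measure (Space d)) =
      c • ((volume : Measure ℝ).prod (volume : Measure W)).map φ := by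
    refine ⟨Measure.addHaarScalarFactor volume
      (((volume : Measure ℝ).prod (volume : Measure W)).map Le), ?_⟩
    have h1 := Measure.isAddLeftInvariant_eq_smul (volume : Measure (Space d))
      (((volume : Measure ℝ).prod (volume : Measure W)).map Le)
    conv_lhs => rw [← map_add_left_eq_self (volume : Measure (Space d)) p, h1]
    rw [Measure.map_smul, Measure.map_map (by fun_prop) Le.continuous.measurable]
    rfl
  have hint : ∀ g : Space d → ℝ, Continuous g →
      IntegrableOn (fun z : W => ∫ t in (0 : ℝ)..1, t ^ (d - 1) * g (p + t • (w + z))) S volume ∧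
      ∫ x in hull (insert p F), g x =
        c * ∫ z in S, ∫ t in (0 : ℝ)..1, t ^ (d - 1) * g (p + t • (w + z)) := by
    intro g hg
    obtain ⟨h1, h2⟩ := setIntegral_coneOver (volume : Measure W) hSc
      (G := g ∘ φ) (hg.comp φ.continuous)
    simp only [hWrank, Function.comp_apply, hφ, Submodule.coe_smul, ← smul_add] at h1 h2
    refine ⟨h1, ?_⟩
    rw [← h2, hKimg, hc, Measure.restrict_smul, integral_smul_nnreal_measure,
      φ.measurableEmbedding.setIntegral_map, φ.injective.preimage_image]
    rw [NNReal.smul_def, smul_eq_mul]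
    congr 1
  have hpow : ∫ t in (0 : ℝ)..1, t ^ (d - 1) = 1 / d := by
    rw [integral_pow, Nat.cast_sub hd, Nat.sub_add_cancel hd, zero_pow (by omega)]
    simp
  have hvolK : volume.real (hull (insert p F)) = c * (volume.real S / d) := by
    have := (hint (fun _ => 1) continuous_const).2
    simpa [hpow, div_eq_mul_inv] using this
  have hvolF : ((Measure.euclideanHausdorffMeasure (d - 1)).restrict (hull F) :
      Measure (Space d)).real Set.univ = volume.real S := by
    rw [hμF, measureReal_def, hembF.map_apply]
    simp [measureReal_def]
  have hKpos := measureReal_hull_pos _ hcard hind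
  have hdpos : (0 : ℝ) < d := by exact_mod_cast hd
  -- positivity of the area follows from positivity of the volume of the cone
  have hSpos : 0 < volume.real S := by
    refine lt_of_le_of_ne measureReal_nonneg fun h => ?_
    rw [hvolK, ← h] at hKpos
    simp at hKpos
  refine ⟨hvolF ▸ hSpos, fun j q hq => ?_⟩
  obtain ⟨hi, hK⟩ := hint (fun x => polyEval q x ^ 2) ((continuous_polyEval q).pow 2)
  have hFint : ∫ x, polyEval q x ^ 2 ∂((Measure.euclideanHausdorffMeasure (d - 1)).restrict
      (hull F)) = ∫ z : W in S, polyEval q (f₀ + (z : Space d)) ^ 2 := by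
    rw [hμF, hembF.integral_map]
  have hcomp : ∫ z : W in S, polyEval q (f₀ + (z : Space d)) ^ 2 ≤
      (j + 1) * (j + d) * ∫ z : W in S, ∫ t in (0 : ℝ)..1,
        t ^ (d - 1) * polyEval q (p + t • (w + z)) ^ 2 := by
    rw [← integral_const_mul]
    refine setIntegral_mono_on ?_ (hi.const_mul _) hSc.measurableSet fun z _ => ?_
    · have : Continuous fun z : W => polyEval q (f₀ + (z : Space d)) ^ 2 :=
        ((continuous_polyEval q).comp (by fun_prop)).pow 2
      exact this.continuousOn.integrableOn_compact hSc
    · obtain ⟨g, hg, hge⟩ := exists_polynomial_on_line q p (w + z)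
      have := sq_eval_one_le (d - 1) j g (hg.trans hq)
      simp only [hge, one_smul] at this
      have e : p + (w + (z : Space d)) = f₀ + z := by simp only [hw]; abel
      rw [e] at this
      refine this.trans_eq ?_
      rw [Nat.cast_sub hd]
      push_cast
      ring
  rw [hFint, hvolK, hvolF, hK]
  calc _ ≤ ((j + 1) * (j + d) * ∫ z : W in S, ∫ t in (0 : ℝ)..1,
        t ^ (d - 1) * polyEval q (p + t • (w + z)) ^ 2) * (c * (volume.real S / d)) :=
        mul_le_mul_of_nonneg_right hcomp (by positivity)
    _ = _ := by ring

/-! ### Propagation from the boundary through the mesh -/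

open Filter Topology

section Simplex

variable {K : Finset (Space d)} (hcard : K.card = d + 1)
    (hind : AffineIndependent ℝ ((↑) : K → Space d))

theorem coord_vertex_eq_zero (i : K) {z : Space d} (hz : z ∈ K) (hzi : z ≠ i) :
    (simplexBasis K hcard hind).coord i z = 0 := by
  have hne : i ≠ ⟨z, hz⟩ := fun h => hzi (congrArg Subtype.val h).symm
  have h := (simplexBasis K hcard hind).coord_apply_ne hne
  rwa [simplexBasis_apply] at h

/-- A barycentric coordinate vanishes on every hull of points that avoids its vertex. -/
theorem coord_eq_zero_of_mem_convexHull {s : Set (Space d)} (i : K) (hs : s ⊆ K) (hi : ↑i ∉ s)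
    {x : Space d} (hx : x ∈ convexHull ℝ s) : (simplexBasis K hcard hind).coord i x = 0 := by
  set b := simplexBasis K hcard hind
  have hconv : Convex ℝ (b.coord i ⁻¹' {0}) := (convex_singleton 0).affine_preimage _
  refine convexHull_min (fun z hz => ?_) hconv hx
  exact coord_vertex_eq_zero hcard hind i (hs hz) fun h => hi (h ▸ hz)

/-- A point of a simplex lies in the face spanned by `G` if its barycentric coordinates at the other
vertices vanish. -/
theorem mem_hull_of_coord_eq_zero {G : Finset (Space d)} (hG : G ⊆ K) {x : Space d}
    (hx : x ∈ hull K)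
    (h0 : ∀ i : K, ↑i ∉ G → (simplexBasis K hcard hind).coord i x = 0) : x ∈ hull G := by
  classical
  have hx' := hx
  rw [hull_eq_coord_nonneg K hcard hind] at hx'
  set b := simplexBasis K hcard hind with hb
  rw [Finset.mem_convexHull']
  set w : Space d → ℝ := fun y => if h : y ∈ K then b.coord ⟨y, h⟩ x else 0 with hw
  have hwK : ∀ i : K, w i = b.coord i x := fun i => by simp [hw]
  have hw0 : ∀ y ∈ K, y ∉ G → w y = 0 := fun y hy hyG => by
    rw [hwK ⟨y, hy⟩]; exact h0 ⟨y, hy⟩ hyG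
  refine ⟨w, fun y hy => ?_, ?_, ?_⟩
  · rw [hwK ⟨y, hG hy⟩]; exact hx' _
  · rw [Finset.sum_subset hG hw0, ← Finset.sum_coe_sort]
    simp only [hwK]
    exact b.sum_coord_apply_eq_one x
  · rw [Finset.sum_subset hG fun y hy hyG => by rw [hw0 y hy hyG, zero_smul],
      ← Finset.sum_coe_sort]
    simp only [hwK]
    exact b.linear_combination_coord_eq_self x

theorem coord_add_smul (i : K) (y u : Space d) (ε : ℝ) :
    (simplexBasis K hcard hind).coord i (y + ε • u) =
      (1 - ε) * (simplexBasis K hcard hind).coord i y +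
        ε * (simplexBasis K hcard hind).coord i (y + u) := by
  have h := ((simplexBasis K hcard hind).coord i).apply_lineMap y (y + u) ε
  simp only [AffineMap.lineMap_apply, vsub_eq_sub, vadd_eq_add, smul_eq_mul,
    add_sub_cancel_left] at h
  rw [add_comm y, h]
  ring

/-- A direction along which the vanishing barycentric coordinates do not decrease points into the
simplex. -/
theorem eventually_add_smul_mem_hull {y u : Space d} (hy : y ∈ hull K)
    (hu : ∀ i, (simplexBasis K hcard hind).coord i y = 0 →
      0 ≤ (simplexBasis K hcard hind).coord i (y + u)) :
    ∀ᶠ ε : ℝ in 𝓝[>] 0, y + ε • u ∈ hull K := by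
  rw [hull_eq_coord_nonneg K hcard hind] at hy ⊢
  simp only [Set.mem_ofPred_eq] at hy ⊢
  rw [eventually_all]
  intro i
  rcases (hy i).eq_or_lt with h | h
  · filter_upwards [self_mem_nhdsWithin] with ε hε
    rw [coord_add_smul, ← h]
    have := mul_nonneg (le_of_lt (Set.mem_Ioi.1 hε)) (hu i h.symm)
    linarith
  · have hcont : Continuous fun ε : ℝ => (1 - ε) * (simplexBasis K hcard hind).coord i y +
        ε * (simplexBasis K hcard hind).coord i (y + u) := by fun_prop
    have : ∀ᶠ ε : ℝ in 𝓝 0, 0 < (1 - ε) * (simplexBasis K hcard hind).coord i y +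
        ε * (simplexBasis K hcard hind).coord i (y + u) :=
      hcont.continuousAt.eventually (lt_mem_nhds (by simpa using h))
    filter_upwards [this.filter_mono nhdsWithin_le_nhds] with ε hε
    rw [coord_add_smul]
    exact hε.le

/-- The barycentric coordinates of two simplices at the vertices opposite to a common facet are
proportional, since both vanish on that facet. -/
theorem coord_eq_coord_mul {K' : Finset (Space d)} (hcard' : K'.card = d + 1)
    (hind' : AffineIndependent ℝ ((↑) : K' → Space d)) (i : K) (v : K')
    (hv : ∀ z ∈ K', z ≠ v → z ∈ K.erase i) (z : Space d) :
    (simplexBasis K hcard hind).coord i z = (simplexBasis K' hcard' hind').coord v z *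
      (simplexBasis K hcard hind).coord i v := by
  set b' := simplexBasis K' hcard' hind' with hb'
  have h1 := Finset.univ.map_affineCombination b' _ (b'.sum_coord_apply_eq_one z)
    ((simplexBasis K hcard hind).coord i)
  rw [b'.affineCombination_coord_eq_self, Finset.affineCombination_eq_linear_combination _ _ _
    (b'.sum_coord_apply_eq_one z)] at h1
  rw [h1, Finset.sum_eq_single v]
  · rfl
  · intro l _ hl
    have hl' := Finset.mem_erase.1 (hv l l.2 fun h => hl (Subtype.ext h))
    rw [Function.comp_apply, hb', simplexBasis_apply,
      coord_vertex_eq_zero hcard hind i hl'.2 hl'.1, smul_zero]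
  · simp

end Simplex

/-- The points `x` for which the line `x + ℝ e` meets the affine span of at most `d - 1`
points form a null set. -/
theorem volume_line_meets_affineSpan_eq_zero (e : Space d) (G : Finset (Space d))
    (hG : G.card + 1 ≤ d) :
    volume {x : Space d | ∃ t : ℝ, x + t • e ∈ affineSpan ℝ (G : Set (Space d))} = 0 := by
  rcases G.eq_empty_or_nonempty with rfl | ⟨g, hg⟩
  · have hempty : {x : Space d | ∃ t : ℝ, x + t • e ∈
        affineSpan ℝ ((∅ : Finset (Space d)) : Set (Space d))} = ∅ := by
      ext x
      simp [AffineSubspace.notMem_bot]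
    rw [hempty, measure_empty]
  set D : Submodule ℝ (Space d) := vectorSpan ℝ (G : Set (Space d)) ⊔ Submodule.span ℝ {e}
  have hD : D ≠ ⊤ := by
    intro h
    have h1 := congrArg (fun S : Submodule ℝ (Space d) => Module.finrank ℝ S) h
    simp only [finrank_top, finrank_euclideanSpace, Fintype.card_fin] at h1
    have h2 := Submodule.finrank_add_le_finrank_add_finrank
      (vectorSpan ℝ (G : Set (Space d))) (Submodule.span ℝ {e})
    have h3 : Module.finrank ℝ (Submodule.span ℝ {e}) ≤ 1 := by
      simpa using finrank_span_le_card ({e} : Set (Space d)) (R := ℝ)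
    have h4 : Module.finrank ℝ (vectorSpan ℝ (G : Set (Space d))) ≤ G.card - 1 := by
      have hpos := Finset.card_pos.2 ⟨g, hg⟩
      have := finrank_vectorSpan_range_le ℝ ((↑) : G → Space d) (n := G.card - 1)
        (by simp; omega)
      rwa [Subtype.range_coe_subtype] at this
    have hpos := Finset.card_pos.2 ⟨g, hg⟩
    change Module.finrank ℝ D ≤ _ at h2
    omega
  have hne : AffineSubspace.mk' g D ≠ ⊤ := by
    intro h
    apply hD
    rw [← AffineSubspace.direction_mk' g D, h, AffineSubspace.direction_top]
  refine measure_mono_null ?_ (Measure.addHaar_affineSubspace volume _ hne)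
  rintro x ⟨t, hx⟩
  rw [SetLike.mem_coe, AffineSubspace.mem_mk', vsub_eq_sub]
  have h1 : x + t • e - g ∈ vectorSpan ℝ (G : Set (Space d)) := by
    rw [← direction_affineSpan]
    exact AffineSubspace.vsub_mem_direction hx (mem_affineSpan ℝ hg)
  have : x - g = (x + t • e - g) + (-t) • e := by module
  rw [this]
  exact Submodule.add_mem_sup h1 (Submodule.smul_mem _ _ (Submodule.mem_span_singleton_self e))

namespace Mesh

variable {Ω : Set (Space d)}

/-- Every element is linked to a boundary facet by a chain of elements with common facets: a
property that passes through common facets and fails on the elements with a boundary facet fails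
everywhere. A line in general position through the elements with the property can only leave them
through a boundary facet. -/
theorem not_of_facet_neighbours (T : Mesh d Ω) (hd : 1 ≤ d) (hΩ : IsOpen Ω) (P : T.Cell → Prop)
    (hstep : ∀ (K K' : T.Cell) (F : T.Facet), F.1 ⊆ K.1 → F.1 ⊆ K'.1 → P K → P K')
    (hbd : ∀ (K : T.Cell) (F : T.Facet), F.1 ⊆ K.1 → T.IsBoundaryFacet F → ¬ P K)
    (K₀ : T.Cell) : ¬ P K₀ := by
  classical
  intro hP₀
  set e : Space d := EuclideanSpace.single ⟨0, hd⟩ 1 with he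
  have he0 : e ≠ 0 := by simp [he]
  -- a point of `K₀` whose line in direction `e` avoids the faces of codimension two
  obtain ⟨x, hxK₀, hx⟩ : ∃ x ∈ hull K₀.1, ∀ K ∈ T.cells, ∀ G ∈ K.powersetCard (d - 1), ∀ t : ℝ,
      x + t • e ∉ hull G := by
    have hnull : volume (⋃ K ∈ T.cells, ⋃ G ∈ K.powersetCard (d - 1),
        {x : Space d | ∃ t : ℝ, x + t • e ∈ affineSpan ℝ (G : Set (Space d))}) = 0 := by
      refine (measure_biUnion_null_iff T.cells.countable_toSet).2 fun K _ => ?_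
      refine (measure_biUnion_null_iff (Finset.countable_toSet _)).2 fun G hG => ?_
      refine volume_line_meets_affineSpan_eq_zero e G ?_
      have := (Finset.mem_powersetCard.1 hG).2
      omega
    have hpos : volume (hull K₀.1) ≠ 0 := fun h => by
      have := measureReal_hull_pos K₀.1 (T.card_cell _ K₀.2) (T.affineIndependent _ K₀.2)
      rw [measureReal_def, h] at this
      simp at this
    obtain ⟨x, hxK, hxN⟩ : (hull K₀.1 \ ⋃ K ∈ T.cells, ⋃ G ∈ K.powersetCard (d - 1),
        {x : Space d | ∃ t : ℝ, x + t • e ∈ affineSpan ℝ (G : Set (Space d))}).Nonempty := by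
      refine nonempty_of_measure_ne_zero (μ := volume) ?_
      rwa [measure_sdiff_null hnull]
    refine ⟨x, hxK, fun K hK G hG t ht => hxN ?_⟩
    simp only [Set.mem_iUnion]
    exact ⟨K, hK, G, hG, t, convexHull_subset_affineSpan _ ht⟩
  -- the last point of the line in the union of the elements with the property
  have hclosed : IsClosedEmbedding fun t : ℝ => x + t • e :=
    (Homeomorph.addLeft x).isClosedEmbedding.comp (isClosedEmbedding_smul_left he0)
  have hUc : IsCompact (⋃ K : {K : T.Cell // P K}, hull K.1.1) :=
    isCompact_iUnion fun K => isCompact_hull _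
  obtain ⟨t, htA, htmax⟩ := (hclosed.isCompact_preimage hUc).exists_isGreatest
    ⟨0, by simpa using ⟨K₀.1, ⟨K₀.2, hP₀⟩, hxK₀⟩⟩
  set y := x + t • e with hy
  have hexit : ∀ K : T.Cell, P K → ¬ ∀ᶠ ε : ℝ in 𝓝[>] 0, y + ε • e ∈ hull K.1 := by
    intro K hPK hev
    obtain ⟨ε, hε, hε0⟩ := (hev.and self_mem_nhdsWithin).exists
    have h1 : t + ε ≤ t := htmax (by
      refine Set.mem_iUnion.2 ⟨⟨K, hPK⟩, ?_⟩
      have : x + (t + ε) • e = y + ε • e := by rw [hy]; module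
      simpa only [this] using hε)
    have : 0 < ε := hε0
    linarith
  -- general position: at most one barycentric coordinate vanishes at `y`
  have hone : ∀ (K : T.Cell) (i j : K.1), y ∈ hull K.1 →
      (simplexBasis K.1 (T.card_cell _ K.2) (T.affineIndependent _ K.2)).coord i y = 0 →
      (simplexBasis K.1 (T.card_cell _ K.2) (T.affineIndependent _ K.2)).coord j y = 0 →
      i = j := by
    intro K i j hyK hi hj
    by_contra hij
    refine hx K.1 K.2 ((K.1.erase i).erase j) ?_ t (mem_hull_of_coord_eq_zero
      (T.card_cell _ K.2) (T.affineIndependent _ K.2)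
      ((Finset.erase_subset _ _).trans (Finset.erase_subset _ _)) hyK ?_)
    · rw [Finset.mem_powersetCard]
      refine ⟨(Finset.erase_subset _ _).trans (Finset.erase_subset _ _), ?_⟩
      rw [Finset.card_erase_of_mem, Finset.card_erase_of_mem i.2, T.card_cell _ K.2]
      · omega
      · exact Finset.mem_erase.2 ⟨fun h => hij (Subtype.ext h.symm), j.2⟩
    · intro l hl
      simp only [Finset.mem_erase, l.2, and_true, not_and_or, not_not] at hl
      rcases hl with hl | hl
      · rwa [Subtype.ext hl]
      · rwa [Subtype.ext hl]
  obtain ⟨⟨K, hPK⟩, hyK⟩ := Set.mem_iUnion.1 htA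
  change y ∈ hull K.1 at hyK
  have hKc := T.card_cell _ K.2
  have hKi := T.affineIndependent _ K.2
  set b := simplexBasis K.1 hKc hKi with hb
  obtain ⟨i₀, hi₀, hneg⟩ : ∃ i, b.coord i y = 0 ∧ b.coord i (y + e) < 0 := by
    by_contra! h
    exact hexit K hPK (eventually_add_smul_mem_hull hKc hKi hyK h)
  have hFcard : (K.1.erase i₀).card = d := by
    rw [Finset.card_erase_of_mem i₀.2, hKc, Nat.add_sub_cancel]
  have hFK : K.1.erase i₀ ⊆ K.1 := Finset.erase_subset _ _
  obtain ⟨F, hF⟩ : ∃ F : T.Facet, F.1 = K.1.erase i₀ :=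
    ⟨⟨K.1.erase i₀, by
      simp only [facets, Finset.mem_biUnion, Finset.mem_powersetCard]
      exact ⟨K.1, K.2, hFK, hFcard⟩⟩, rfl⟩
  have hyF : y ∈ hull (K.1.erase i₀) := by
    refine mem_hull_of_coord_eq_zero hKc hKi hFK hyK fun i hi => ?_
    simp only [Finset.mem_erase, i.2, and_true, not_not] at hi
    rwa [Subtype.ext hi]
  have hypos : ∀ i, i ≠ i₀ → 0 < b.coord i y := by
    intro i hi
    rw [hull_eq_coord_nonneg K.1 hKc hKi] at hyK
    refine lt_of_le_of_ne (hyK i) fun h => hi ?_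
    exact hone K i i₀ (by rwa [hull_eq_coord_nonneg K.1 hKc hKi]) h.symm hi₀
  have hinter : ∀ (K' : T.Cell) (z : Space d), z ∈ hull K.1 → z ∈ hull K'.1 → ∀ i : K.1,
      ↑i ∉ K'.1 → b.coord i z = 0 := by
    intro K' z hz hz' i hi
    have hz2 : z ∈ hull K.1 ∩ hull K'.1 := ⟨hz, hz'⟩
    rw [T.conforming _ K.2 _ K'.2] at hz2
    exact coord_eq_zero_of_mem_convexHull hKc hKi i Set.inter_subset_left (fun h => hi h.2) hz2
  by_cases hex : ∃ K' : T.Cell, K' ≠ K ∧ K.1.erase i₀ ⊆ K'.1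
  · -- the line enters the element on the other side of the facet
    obtain ⟨K', hne, hFK'⟩ := hex
    have hPK' : P K' := hstep K K' F (hF ▸ hFK) (hF ▸ hFK') hPK
    have hKc' := T.card_cell _ K'.2
    have hKi' := T.affineIndependent _ K'.2
    set b' := simplexBasis K'.1 hKc' hKi' with hb'
    have hi₀K' : ↑i₀ ∉ K'.1 := by
      intro h
      apply hne
      apply Subtype.ext
      symm
      refine Finset.eq_of_subset_of_card_le (fun z hz => ?_) (by rw [hKc, hKc'])
      by_cases hzi : z = i₀
      · exact hzi ▸ h
      · exact hFK' (Finset.mem_erase.2 ⟨hzi, hz⟩)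
    obtain ⟨v, hvK', hvF⟩ := Finset.exists_mem_notMem_of_card_lt_card
      (show (K.1.erase i₀).card < K'.1.card by omega)
    have hyK' : y ∈ hull K'.1 := convexHull_mono (by exact_mod_cast hFK') hyF
    have hvy : b'.coord ⟨v, hvK'⟩ y = 0 :=
      coord_eq_zero_of_mem_convexHull hKc' hKi' ⟨v, hvK'⟩ (by exact_mod_cast hFK')
        (by exact_mod_cast hvF) hyF
    have hK'eq : insert v (K.1.erase i₀) = K'.1 := by
      refine Finset.eq_of_subset_of_card_le (Finset.insert_subset hvK' hFK') ?_
      rw [Finset.card_insert_of_notMem hvF, hFcard, hKc']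
    -- both coordinates vanish on the common facet, so they are proportional
    have hprop : ∀ z, b.coord i₀ z = b'.coord ⟨v, hvK'⟩ z * b.coord i₀ v := by
      refine coord_eq_coord_mul hKc hKi hKc' hKi' i₀ ⟨v, hvK'⟩ fun z hz hzv => ?_
      rw [← hK'eq, Finset.mem_insert] at hz
      exact hz.resolve_left hzv
    by_cases hv : 0 < b.coord i₀ v
    · -- if both elements were on the same side of the facet, they would meet outside it
      have hev : ∀ᶠ ε : ℝ in 𝓝[>] 0, y + ε • (v - y) ∈ hull K.1 := by
        refine eventually_add_smul_mem_hull hKc hKi hyK fun i hi => ?_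
        have : i = i₀ := by
          by_contra h
          exact (hypos i h).ne' hi
        rw [this, add_sub_cancel]
        exact hv.le
      have h1 : ∀ᶠ ε : ℝ in 𝓝[>] 0, ε < 1 :=
        (gt_mem_nhds zero_lt_one).filter_mono nhdsWithin_le_nhds
      obtain ⟨ε, ⟨hεK, hε1⟩, hε0⟩ := ((hev.and h1).and self_mem_nhdsWithin).exists
      have hε0' : 0 < ε := hε0
      have hεK' : y + ε • (v - y) ∈ hull K'.1 :=
        (convex_convexHull ℝ _).add_smul_sub_mem hyK' (subset_convexHull _ _ hvK')
          ⟨hε0'.le, hε1.le⟩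
      have := hinter K' _ hεK hεK' i₀ hi₀K'
      rw [coord_add_smul, add_sub_cancel, ← hb, hi₀] at this
      have := mul_pos hε0' hv
      linarith
    · refine hexit K' hPK' (eventually_add_smul_mem_hull hKc' hKi' hyK' fun i hi => ?_)
      rw [hone K' i ⟨v, hvK'⟩ hyK' hi hvy, ← hb']
      rw [hprop] at hneg
      by_contra! hlt
      nlinarith
  · -- no element on the other side: the facet lies on the boundary
    refine hbd K F (hF ▸ hFK) ?_ hPK
    rw [IsBoundaryFacet, hF]
    intro z hz
    have hzK : z ∈ hull K.1 := convexHull_mono (by exact_mod_cast hFK) hz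
    have hzcl : z ∈ closure Ω := by
      rw [T.closure_eq]
      exact Set.mem_biUnion K.2 hzK
    rw [frontier, hΩ.interior_eq]
    refine ⟨hzcl, fun hzΩ => ?_⟩
    -- near a point of `Ω` on the facet there is a point of `Ω` in its relative interior, and
    -- only the element `K` contains that point
    have hcont : Continuous fun s : ℝ => z + s • (y - z) := by fun_prop
    have hevΩ : ∀ᶠ s : ℝ in 𝓝[>] 0, z + s • (y - z) ∈ Ω :=
      (hcont.continuousAt.eventually (hΩ.mem_nhds (by simpa using hzΩ))).filter_mono
        nhdsWithin_le_nhds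
    have h1 : ∀ᶠ s : ℝ in 𝓝[>] 0, s < 1 :=
      (gt_mem_nhds zero_lt_one).filter_mono nhdsWithin_le_nhds
    obtain ⟨s, ⟨hsΩ, hs1⟩, hs0⟩ := ((hevΩ.and h1).and self_mem_nhdsWithin).exists
    have hs0' : 0 < s := hs0
    set z' := z + s • (y - z) with hz'
    have hz'F : z' ∈ hull (K.1.erase i₀) :=
      (convex_convexHull ℝ _).add_smul_sub_mem hz hyF ⟨hs0'.le, hs1.le⟩
    have hz'K : z' ∈ hull K.1 := convexHull_mono (by exact_mod_cast hFK) hz'F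
    have hother : ∀ K' : T.Cell, K' ≠ K → z' ∉ hull K'.1 := by
      intro K' hne hz'K'
      apply hex
      refine ⟨K', hne, fun v hv => ?_⟩
      by_contra hvK'
      have h0 := hinter K' z' hz'K hz'K' ⟨v, hFK hv⟩ hvK'
      rw [hz', coord_add_smul, add_sub_cancel, ← hb] at h0
      have hp := hypos ⟨v, hFK hv⟩ fun h => (Finset.mem_erase.1 hv).1 (congrArg Subtype.val h)
      have hzn : 0 ≤ b.coord ⟨v, hFK hv⟩ z := by
        rw [hull_eq_coord_nonneg K.1 hKc hKi] at hzK
        exact hzK _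
      have := mul_pos hs0' hp
      have := mul_nonneg (sub_nonneg.2 hs1.le) hzn
      linarith
    have hopen : IsOpen (Ω \ ⋃ K' : {K' : T.Cell // K' ≠ K}, hull K'.1.1) :=
      hΩ.sdiff (isClosed_iUnion_of_finite fun K' => (isCompact_hull _).isClosed)
    have hsub : (Ω \ ⋃ K' : {K' : T.Cell // K' ≠ K}, hull K'.1.1) ⊆ hull K.1 := by
      rintro p ⟨hpΩ, hp⟩
      have hpc : p ∈ closure Ω := subset_closure hpΩ
      rw [T.closure_eq, Set.mem_iUnion₂] at hpc
      obtain ⟨K', hK', hpK'⟩ := hpc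
      by_cases h : (⟨K', hK'⟩ : T.Cell) = K
      · rw [← h]; exact hpK'
      · exact absurd (Set.mem_iUnion.2 ⟨⟨⟨K', hK'⟩, h⟩, hpK'⟩) hp
    have hint : z' ∈ interior (hull K.1) := by
      refine interior_maximal hsub hopen ⟨hsΩ, fun h => ?_⟩
      obtain ⟨K', hK'⟩ := Set.mem_iUnion.1 h
      exact hother K'.1 K'.2 hK'
    rw [interior_hull_eq_coord_pos K.1 hKc hKi] at hint
    have := hint i₀
    rw [coord_eq_zero_of_mem_convexHull hKc hKi i₀ (by exact_mod_cast hFK) (by simp) hz'F] at this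
    exact lt_irrefl _ this

end Mesh

/-! ### Polynomials and coercivity on one element -/

theorem polyEval_add (p q : MvPolynomial (Fin d) ℝ) (x : Space d) :
    polyEval (p + q) x = polyEval p x + polyEval q x := by simp [polyEval]

theorem polyEval_smul (c : ℝ) (p : MvPolynomial (Fin d) ℝ) (x : Space d) :
    polyEval (c • p) x = c * polyEval p x := by simp [polyEval, MvPolynomial.smul_eval]

theorem polyGrad_add (p q : MvPolynomial (Fin d) ℝ) (x : Space d) :
    polyGrad (p + q) x = polyGrad p x + polyGrad q x := by
  ext i; simp [polyGrad, polyEval]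

theorem polyGrad_smul (c : ℝ) (p : MvPolynomial (Fin d) ℝ) (x : Space d) :
    polyGrad (c • p) x = c • polyGrad p x := by
  ext i; simp [polyGrad, polyEval, MvPolynomial.smul_eval]

theorem continuous_polyGrad (p : MvPolynomial (Fin d) ℝ) : Continuous (polyGrad p) :=
  (PiLp.continuous_toLp 2 _).comp (continuous_pi fun _ => continuous_polyEval _)

theorem polyDirDeriv_add (n : Space d) (p q : MvPolynomial (Fin d) ℝ) :
    polyDirDeriv n (p + q) = polyDirDeriv n p + polyDirDeriv n q := by
  simp [polyDirDeriv, Finset.sum_add_distrib]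

theorem polyDirDeriv_smul (n : Space d) (c : ℝ) (p : MvPolynomial (Fin d) ℝ) :
    polyDirDeriv n (c • p) = c • polyDirDeriv n p := by
  simp [polyDirDeriv, Finset.smul_sum, smul_comm c]

theorem totalDegree_polyDirDeriv_le (n : Space d) (p : MvPolynomial (Fin d) ℝ) :
    (polyDirDeriv n p).totalDegree ≤ p.totalDegree - 1 := by
  refine (MvPolynomial.totalDegree_finsetSum _ _).trans (Finset.sup_le fun i _ => ?_)
  refine (MvPolynomial.totalDegree_smul_le _ _).trans ?_
  refine Finset.sup_le fun m hm => ?_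
  rw [MvPolynomial.mem_support_iff, MvPolynomial.coeff_pderiv] at hm
  have h := MvPolynomial.le_totalDegree (MvPolynomial.mem_support_iff.2 (left_ne_zero_of_mul hm))
  rw [Finsupp.sum_add_index' (fun _ => rfl) (fun _ _ _ => rfl), Finsupp.sum_single_index rfl] at h
  omega

theorem eq_C_of_pderiv_eq_zero {σ : Type*} {p : MvPolynomial σ ℝ}
    (h : ∀ i, MvPolynomial.pderiv i p = 0) : p = MvPolynomial.C (p.coeff 0) := by
  classical
  ext m
  rw [MvPolynomial.coeff_C]
  split_ifs with hm
  · rw [hm]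
  · obtain ⟨i, hi⟩ := Finsupp.ne_iff.1 (Ne.symm hm)
    have h1 : m - Finsupp.single i 1 + Finsupp.single i 1 = m :=
      Finsupp.sub_add_single_one_cancel hi
    have h2 := MvPolynomial.coeff_pderiv (i := i) p (m - Finsupp.single i 1)
    rw [h, h1, MvPolynomial.coeff_zero] at h2
    exact (mul_eq_zero.1 h2.symm).resolve_right (by positivity)

theorem eq_zero_of_polyEval_eq_zero {p : MvPolynomial (Fin d) ℝ} {U : Set (Space d)}
    (hU : IsOpen U) (hne : U.Nonempty) (h : ∀ x ∈ U, polyEval p x = 0) : p = 0 := by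
  obtain ⟨x₀, hx₀⟩ := hne
  have hU' : IsOpen ((WithLp.toLp 2 : (Fin d → ℝ) → Space d) ⁻¹' U) :=
    hU.preimage (PiLp.continuous_toLp 2 _)
  obtain ⟨ε, hε, hball⟩ := Metric.isOpen_iff.1 hU' (fun i => x₀ i) hx₀
  refine MvPolynomial.funext_set (fun i => Metric.ball (x₀ i) ε) (fun i => ?_) fun x hx => ?_
  · rw [Real.ball_eq_Ioo]
    exact Set.Ioo_infinite (by linarith)
  · rw [← ball_pi _ hε] at hx
    rw [map_zero]
    exact h _ (hball hx)

/-- A polynomial whose gradient has zero energy on a nondegenerate simplex is constant. -/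
theorem eq_C_of_integral_norm_polyGrad_eq_zero {K : Finset (Space d)} (hcard : K.card = d + 1)
    (hind : AffineIndependent ℝ ((↑) : K → Space d)) {p : MvPolynomial (Fin d) ℝ}
    (h : ∫ x in hull K, ‖polyGrad p x‖ ^ 2 = 0) : p = MvPolynomial.C (p.coeff 0) := by
  have hcont : Continuous fun x => ‖polyGrad p x‖ ^ 2 := (continuous_polyGrad p).norm.pow 2
  have hzero : ∀ x ∈ interior (hull K), ‖polyGrad p x‖ ^ 2 = 0 := by
    have h1 : ∫ x in interior (hull K), ‖polyGrad p x‖ ^ 2 = 0 := by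
      refine le_antisymm ?_ (integral_nonneg fun x => sq_nonneg _)
      rw [← h]
      exact setIntegral_mono_set (hcont.continuousOn.integrableOn_compact (Mesh.isCompact_hull K))
        (Filter.Eventually.of_forall fun x => sq_nonneg _) interior_subset.eventuallyLE
    rw [integral_eq_zero_iff_of_nonneg (fun x => sq_nonneg _)
      ((hcont.continuousOn.integrableOn_compact (Mesh.isCompact_hull K)).mono_set
        interior_subset)] at h1
    exact Measure.eqOn_open_of_ae_eq h1 isOpen_interior hcont.continuousOn continuousOn_const
  refine eq_C_of_pderiv_eq_zero fun i => eq_zero_of_polyEval_eq_zero isOpen_interior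
    (interior_hull_nonempty K hcard hind) fun x hx => ?_
  have h2 : polyGrad p x = 0 := by simpa using hzero x hx
  exact congrArg (fun v : Space d => v i) h2

/-- Coercivity on one element, in abstract form: `G` is the energy of the gradient, the vectors
`g F` are the normal derivatives, the vectors `w F` the projected jumps and `A F` the areas. Young's
inequality is used with a constant between the trace constant `C` and `γ`, so that both energies
keep a positive part. -/
theorem element_form_coercive {ι : Type*} {E : ι → Type*} [∀ i, NormedAddCommGroup (E i)]
    [∀ i, InnerProductSpace ℝ (E i)] (s : Finset ι) (hs : s.Nonempty) (A : ι → ℝ)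
    (hA : ∀ i ∈ s, 0 < A i) {a γ C vol G : ℝ} (ha : 0 < a) (hC : 0 < C) (hγ : C < γ)
    (hvol : 0 < vol) (hG : 0 ≤ G) (g w : ∀ i, E i)
    (hg : ∀ i ∈ s, ‖g i‖ ^ 2 * vol ≤ C * A i * G) :
    0 ≤ a * G - 2 * ∑ i ∈ s, inner ℝ (a • g i) (w i) +
        ∑ i ∈ s, inner ℝ ((a * γ / A i * ∑ j ∈ s, A j ^ 2 / vol) • w i) (w i) ∧
    (a * G - 2 * ∑ i ∈ s, inner ℝ (a • g i) (w i) +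
        ∑ i ∈ s, inner ℝ ((a * γ / A i * ∑ j ∈ s, A j ^ 2 / vol) • w i) (w i) = 0 →
      G = 0 ∧ ∀ i ∈ s, w i = 0) := by
  set S := ∑ j ∈ s, A j ^ 2 with hS
  have hSpos : 0 < S := Finset.sum_pos (fun i hi => pow_pos (hA i hi) 2) hs
  set γ' := (C + γ) / 2 with hγ'
  have hγ'C : C < γ' := by rw [hγ']; linarith
  have hγ'γ : γ' < γ := by rw [hγ']; linarith
  have hγ'0 : 0 < γ' := hC.trans hγ'C
  have hsum : ∑ j ∈ s, A j ^ 2 / vol = S / vol := by rw [hS, Finset.sum_div]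
  -- Young's inequality on every facet
  have hyoung : ∀ i ∈ s, 2 * inner ℝ (a • g i) (w i) ≤
      a * (C / γ') * G * (A i ^ 2 / S) + a * γ' / A i * (S / vol) * ‖w i‖ ^ 2 := by
    intro i hi
    have hAi := hA i hi
    have h1 : inner ℝ (a • g i) (w i) ≤ a * (‖g i‖ * ‖w i‖) := by
      rw [real_inner_smul_left]
      exact mul_le_mul_of_nonneg_left (real_inner_le_norm _ _) ha.le
    -- with this weight the trace constants of the facets add up to `C / γ' < 1`
    set β := A i * vol / (γ' * S) with hβ
    have hβ0 : 0 < β := by positivity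
    have h2 : 2 * (‖g i‖ * ‖w i‖) ≤ β * ‖g i‖ ^ 2 + β⁻¹ * ‖w i‖ ^ 2 := by
      have h3 : 0 ≤ β⁻¹ * (β * ‖g i‖ - ‖w i‖) ^ 2 := by positivity
      have h4 : β⁻¹ * (β * ‖g i‖ - ‖w i‖) ^ 2 =
          β * ‖g i‖ ^ 2 + β⁻¹ * ‖w i‖ ^ 2 - 2 * (‖g i‖ * ‖w i‖) := by
        field_simp
        ring
      linarith
    have h5 : β * ‖g i‖ ^ 2 ≤ C / γ' * G * (A i ^ 2 / S) := by
      calc β * ‖g i‖ ^ 2 = A i / (γ' * S) * (‖g i‖ ^ 2 * vol) := by rw [hβ]; ring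
        _ ≤ A i / (γ' * S) * (C * A i * G) :=
          mul_le_mul_of_nonneg_left (hg i hi) (by positivity)
        _ = _ := by field_simp
    have h6 : β⁻¹ = γ' / A i * (S / vol) := by rw [hβ]; field_simp
    calc 2 * inner ℝ (a • g i) (w i) ≤ a * (2 * (‖g i‖ * ‖w i‖)) := by linarith
      _ ≤ a * (C / γ' * G * (A i ^ 2 / S) + γ' / A i * (S / vol) * ‖w i‖ ^ 2) := by
        rw [← h6]
        exact mul_le_mul_of_nonneg_left (h2.trans (by linarith)) ha.le
      _ = _ := by ring
  have hsumyoung := Finset.sum_le_sum hyoung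
  rw [← Finset.mul_sum, Finset.sum_add_distrib, ← Finset.mul_sum, ← Finset.sum_div, ← hS,
    div_self hSpos.ne', mul_one] at hsumyoung
  have hstab : ∑ i ∈ s, inner ℝ ((a * γ / A i * ∑ j ∈ s, A j ^ 2 / vol) • w i) (w i) =
      ∑ i ∈ s, a * γ' / A i * (S / vol) * ‖w i‖ ^ 2 +
        ∑ i ∈ s, a * (γ - γ') / A i * (S / vol) * ‖w i‖ ^ 2 := by
    rw [← Finset.sum_add_distrib, hsum]
    refine Finset.sum_congr rfl fun i _ => ?_
    rw [real_inner_smul_left, real_inner_self_eq_norm_sq]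
    ring
  have hc1 : 0 < a * (1 - C / γ') := mul_pos ha (sub_pos.2 ((div_lt_one hγ'0).2 hγ'C))
  have hterm : ∀ i ∈ s, 0 ≤ a * (γ - γ') / A i * (S / vol) * ‖w i‖ ^ 2 := fun i hi => by
    have := hA i hi
    have := sub_pos.2 hγ'γ
    positivity
  have hlow : a * (1 - C / γ') * G + ∑ i ∈ s, a * (γ - γ') / A i * (S / vol) * ‖w i‖ ^ 2 ≤
      a * G - 2 * ∑ i ∈ s, inner ℝ (a • g i) (w i) +
        ∑ i ∈ s, inner ℝ ((a * γ / A i * ∑ j ∈ s, A j ^ 2 / vol) • w i) (w i) := by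
    rw [hstab]
    have : a * (1 - C / γ') * G = a * G - a * (C / γ') * G := by ring
    linarith
  have hGt : 0 ≤ a * (1 - C / γ') * G := mul_nonneg hc1.le hG
  have hSt := Finset.sum_nonneg hterm
  refine ⟨(add_nonneg hGt hSt).trans hlow, fun h0 => ?_⟩
  rw [h0] at hlow
  refine ⟨?_, fun i hi => ?_⟩
  · have : a * (1 - C / γ') * G = 0 := le_antisymm (by linarith) hGt
    exact (mul_eq_zero.1 this).resolve_left hc1.ne'
  · have h1 := (Finset.sum_eq_zero_iff_of_nonneg hterm).1 (le_antisymm (by linarith) hSt) i hi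
    have h2 : 0 < a * (γ - γ') / A i * (S / vol) := by
      have := hA i hi
      have := sub_pos.2 hγ'γ
      positivity
    simpa using (mul_eq_zero.1 h1).resolve_left h2.ne'

namespace Mesh

variable {Ω : Set (Space d)}

theorem facetMeasure_sharp_trace (T : Mesh d Ω) (hd : 1 ≤ d) {K : T.Cell} {F : T.Facet}
    (hF : F ∈ T.facetsOf K) :
    0 < T.facetArea F ∧ ∀ (j : ℕ) (q : MvPolynomial (Fin d) ℝ), q.totalDegree ≤ j →
      (∫ x, polyEval q x ^ 2 ∂(T.facetMeasure F)) * T.cellVolume K ≤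
        (j + 1) * (j + d) / d * T.facetArea F * ∫ x in hull K.1, polyEval q x ^ 2 := by
  have hFK : F.1 ⊆ K.1 := by simpa [facetsOf] using hF
  exact sharp_trace_inequality hd K.1 F.1 (T.card_cell _ K.2) (T.affineIndependent _ K.2) hFK
    (T.card_facet F)

theorem facetsOf_nonempty (T : Mesh d Ω) (K : T.Cell) : (T.facetsOf K).Nonempty := by
  classical
  obtain ⟨F, hFK, hF⟩ := Finset.exists_subset_card_eq (s := K.1) (n := d)
    (by rw [T.card_cell _ K.2]; omega)
  refine ⟨⟨F, ?_⟩, by simpa [facetsOf] using hFK⟩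
  simp only [facets, Finset.mem_biUnion, Finset.mem_powersetCard]
  exact ⟨K.1, K.2, hFK, hF⟩

theorem norm_outwardNormal_le (T : Mesh d Ω) (K : T.Cell) (F : T.Facet) :
    ‖T.outwardNormal K F‖ ≤ 1 := by
  unfold outwardNormal
  set v := (vectorSpan ℝ (F.1 : Set (Space d)))ᗮ.starProjection
    (F.1.centroid ℝ id - K.1.centroid ℝ id)
  by_cases h : v = 0
  · simp [h]
  · exact (NormedSpace.norm_normalize_eq_one_iff.2 h).le

theorem norm_trace_sq (T : Mesh d Ω) (F : T.Facet) (q : MvPolynomial (Fin d) ℝ) :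
    ‖T.trace F q‖ ^ 2 = ∫ x, polyEval q x ^ 2 ∂(T.facetMeasure F) := by
  rw [← real_inner_self_eq_norm_sq, L2.inner_def]
  refine integral_congr_ae ?_
  filter_upwards [(T.memLp_polyEval F q).coeFn_toLp] with x hx
  change inner ℝ ((T.memLp_polyEval F q).toLp _ x) ((T.memLp_polyEval F q).toLp _ x) = _
  rw [hx]
  simp [sq]

theorem norm_trace_C_sq (T : Mesh d Ω) (F : T.Facet) (c : ℝ) :
    ‖T.trace F (MvPolynomial.C c)‖ ^ 2 = c ^ 2 * T.facetArea F := by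
  rw [norm_trace_sq]
  simp [polyEval, facetArea, measureReal_def, mul_comm]

/-- The sharp trace inequality for normal derivatives of polynomials of degree at most `k`. -/
theorem norm_trace_polyDirDeriv_sq_le (T : Mesh d Ω) (hd : 1 ≤ d) {k : ℕ} (hk : 1 ≤ k)
    {K : T.Cell} {F : T.Facet} (hF : F ∈ T.facetsOf K) {n : Space d} (hn : ‖n‖ ≤ 1)
    {p : MvPolynomial (Fin d) ℝ} (hp : p.totalDegree ≤ k) :
    ‖T.trace F (polyDirDeriv n p)‖ ^ 2 * T.cellVolume K ≤
      (k : ℝ) * ((k : ℝ) + (d : ℝ) - 1) / (d : ℝ) * T.facetArea F *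
        ∫ x in hull K.1, ‖polyGrad p x‖ ^ 2 := by
  obtain ⟨hFpos, h⟩ := T.facetMeasure_sharp_trace hd hF
  rw [norm_trace_sq]
  refine (h (k - 1) (polyDirDeriv n p)
    ((totalDegree_polyDirDeriv_le n p).trans (Nat.sub_le_sub_right hp 1))).trans ?_
  have hcast : (((k - 1 : ℕ) : ℝ) + 1) * (((k - 1 : ℕ) : ℝ) + d) / d =
      (k : ℝ) * ((k : ℝ) + (d : ℝ) - 1) / (d : ℝ) := by
    rw [Nat.cast_sub hk]
    push_cast
    ring
  rw [hcast]
  have hk' : (1 : ℝ) ≤ k := by exact_mod_cast hk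
  have hd' : (1 : ℝ) ≤ d := by exact_mod_cast hd
  refine mul_le_mul_of_nonneg_left ?_ (mul_nonneg (div_nonneg (mul_nonneg (by linarith)
    (by linarith)) (by linarith)) hFpos.le)
  refine setIntegral_mono_on ?_ ?_ (isCompact_hull K.1).measurableSet fun x _ => ?_
  · exact ((continuous_polyEval _).pow 2).continuousOn.integrableOn_compact (isCompact_hull K.1)
  · exact ((continuous_polyGrad p).norm.pow 2).continuousOn.integrableOn_compact
      (isCompact_hull K.1)
  · rw [polyEval_polyDirDeriv, sq_le_sq, abs_norm]
    exact (abs_real_inner_le_norm _ _).trans (mul_le_of_le_one_right (norm_nonneg _) hn)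

end Mesh

/-! ### The discrete problem -/

namespace Mesh

variable {Ω : Set (Space d)} (T : Mesh d Ω)

instance (k : ℕ) : FiniteDimensional ℝ (T.V k) := by
  let e : T.V k →ₗ[ℝ] (T.Cell → MvPolynomial.restrictTotalDegree (Fin d) ℝ k) :=
    LinearMap.pi fun K => ((LinearMap.proj K).comp (T.V k).subtype).codRestrict _
      fun u => Submodule.mem_pi.1 u.2 K trivial
  refine FiniteDimensional.of_injective e fun u v huv => ?_
  ext1
  funext K
  exact congrArg Subtype.val (congrFun huv K)

instance (m : ℕ) : FiniteDimensional ℝ (T.M0 m) := by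
  let e : T.M0 m →ₗ[ℝ] ((F : T.Facet) → T.facetPoly m F) :=
    LinearMap.pi fun F => ((LinearMap.proj F).comp (T.M0 m).subtype).codRestrict _
      fun u => Submodule.mem_pi.1 u.2.1 F trivial
  refine FiniteDimensional.of_injective e fun u v huv => ?_
  ext1
  funext F
  exact congrArg Subtype.val (congrFun huv F)

section Form

variable (a : T.Cell → ℝ) (α : T.Cell → T.Facet → ℝ) {k m : ℕ}

theorem primalForm_comm (u v : T.V k × T.M0 m) :
    T.primalForm a α u v = T.primalForm a α v u := by
  unfold primalForm
  refine Finset.sum_congr rfl fun K _ => ?_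
  have h1 : ∀ x, inner ℝ (polyGrad (u.1.1 K) x) (polyGrad (v.1.1 K) x) =
      inner ℝ (polyGrad (v.1.1 K) x) (polyGrad (u.1.1 K) x) := fun x => real_inner_comm _ _
  have h2 : ∀ F, inner ℝ (α K F • (T.proj m F (T.trace F (u.1.1 K)) - u.2.1 F))
      (T.proj m F (T.trace F (v.1.1 K)) - v.2.1 F) =
      inner ℝ (α K F • (T.proj m F (T.trace F (v.1.1 K)) - v.2.1 F))
      (T.proj m F (T.trace F (u.1.1 K)) - u.2.1 F) := fun F => by
    rw [real_inner_smul_left, real_inner_smul_left, real_inner_comm]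
  simp only [h1, h2]
  ring

theorem primalForm_add_left (u u' v : T.V k × T.M0 m) :
    T.primalForm a α (u + u') v = T.primalForm a α u v + T.primalForm a α u' v := by
  unfold primalForm
  rw [← Finset.sum_add_distrib]
  refine Finset.sum_congr rfl fun K _ => ?_
  have e1 : (u + u').1.1 K = u.1.1 K + u'.1.1 K := rfl
  have e2 : ∀ F, (u + u').2.1 F = u.2.1 F + u'.2.1 F := fun F => rfl
  have hint : ∀ w : T.V k × T.M0 m, IntegrableOn
      (fun x => a K * inner ℝ (polyGrad (w.1.1 K) x) (polyGrad (v.1.1 K) x)) (hull K.1) := fun w =>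
    ((continuous_const.mul ((continuous_polyGrad _).inner
      (continuous_polyGrad _))).continuousOn).integrableOn_compact (isCompact_hull K.1)
  have h1 : ∫ x in hull K.1, a K * inner ℝ (polyGrad ((u + u').1.1 K) x) (polyGrad (v.1.1 K) x) =
      (∫ x in hull K.1, a K * inner ℝ (polyGrad (u.1.1 K) x) (polyGrad (v.1.1 K) x)) +
      ∫ x in hull K.1, a K * inner ℝ (polyGrad (u'.1.1 K) x) (polyGrad (v.1.1 K) x) := by
    rw [← integral_add (hint u) (hint u')]
    simp only [e1, polyGrad_add, inner_add_left, mul_add]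
  rw [h1]
  simp only [e1, e2, polyDirDeriv_add, map_add, smul_add, inner_add_left, smul_sub,
    inner_sub_left, inner_sub_right, inner_add_right, Finset.sum_add_distrib,
    Finset.sum_sub_distrib]
  ring

theorem primalForm_smul_left (c : ℝ) (u v : T.V k × T.M0 m) :
    T.primalForm a α (c • u) v = c * T.primalForm a α u v := by
  unfold primalForm
  rw [Finset.mul_sum]
  refine Finset.sum_congr rfl fun K _ => ?_
  have e1 : (c • u).1.1 K = c • u.1.1 K := rfl
  have e2 : ∀ F, (c • u).2.1 F = c • u.2.1 F := fun F => rfl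
  simp only [e1, e2, polyGrad_smul, polyDirDeriv_smul, map_smul, ← smul_sub, real_inner_smul_left,
    real_inner_smul_right, mul_add, mul_sub, Finset.mul_sum, ← integral_const_mul]
  congr 1
  · congr 1
    congr 1
    · refine integral_congr_ae (Filter.Eventually.of_forall fun x => ?_)
      simp only
      ring
    · refine Finset.sum_congr rfl fun F _ => ?_
      ring
  · refine Finset.sum_congr rfl fun F _ => ?_
    ring

/-- The primal form as a bilinear map. -/
noncomputable def primalBilin : (T.V k × T.M0 m) →ₗ[ℝ] (T.V k × T.M0 m) →ₗ[ℝ] ℝ :=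
  LinearMap.mk₂ ℝ (T.primalForm a α) (T.primalForm_add_left a α)
    (fun c u v => by rw [primalForm_smul_left, smul_eq_mul])
    (fun u v w => by
      rw [primalForm_comm, primalForm_add_left, primalForm_comm, T.primalForm_comm a α w])
    (fun c u v => by
      rw [primalForm_comm, primalForm_smul_left, primalForm_comm, smul_eq_mul])

end Form

/-- The boundary of the domain is a null set, so that `f` is square integrable on every closed
element. -/
theorem memLp_hull {f : Space d → ℝ}
    (hf : MemLp f 2 (volume.restrict Ω)) (K : T.Cell) :
    MemLp f 2 (volume.restrict (hull K.1)) := by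
  have hfr : volume (frontier Ω) = 0 := by
    refine measure_mono_null T.frontier_subset ?_
    refine (measure_biUnion_null_iff T.cells.countable_toSet).2 fun K hK => ?_
    refine (measure_biUnion_null_iff (Finset.countable_toSet _)).2 fun F hF => ?_
    refine measure_mono_null (convexHull_subset_affineSpan _) ?_
    refine Measure.addHaar_affineSubspace volume _ fun h => ?_
    obtain ⟨hFK, hFc⟩ := Finset.mem_powersetCard.1 hF
    obtain ⟨p, hpK, hpF⟩ := Finset.exists_mem_notMem_of_card_lt_card
      (show F.card < K.card by rw [hFc, T.card_cell _ hK]; omega)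
    refine notMem_affineSpan_of_notMem (T.affineIndependent _ hK) hFK hpK hpF ?_
    rw [h]
    exact AffineSubspace.mem_top _ _ _
  have hsub : hull K.1 ⊆ closure Ω := by
    rw [T.closure_eq]
    exact Set.subset_biUnion_of_mem (u := fun K : Finset (Space d) => hull K) K.2
  have hle : volume.restrict (closure Ω) = volume.restrict Ω := by
    refine Measure.restrict_congr_set ?_
    rw [closure_eq_self_union_frontier]
    exact union_ae_eq_left_of_ae_eq_empty (by rwa [ae_eq_empty])
  rw [← hle] at hf
  exact hf.mono_measure (Measure.restrict_mono hsub le_rfl)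

theorem integrableOn_mul_polyEval {f : Space d → ℝ} {K : T.Cell}
    (hf : MemLp f 2 (volume.restrict (hull K.1))) (p : MvPolynomial (Fin d) ℝ) :
    IntegrableOn (fun x => f x * polyEval p x) (hull K.1) := by
  have : IsFiniteMeasure (volume.restrict (hull K.1)) :=
    isFiniteMeasure_restrict.2 (isCompact_hull K.1).measure_lt_top.ne
  exact IntegrableOn.mul_continuousOn (μ := volume) (hf.integrable (by norm_num))
    (continuous_polyEval p).continuousOn (isCompact_hull K.1)

/-- The load as a linear functional. -/
noncomputable def primalLoadLinear {f : Space d → ℝ}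
    (hf : ∀ K : T.Cell, MemLp f 2 (volume.restrict (hull K.1))) {k m : ℕ} :
    (T.V k × T.M0 m) →ₗ[ℝ] ℝ where
  toFun v := T.primalLoad f v
  map_add' u v := by
    unfold primalLoad
    rw [← Finset.sum_add_distrib]
    refine Finset.sum_congr rfl fun K _ => ?_
    rw [← integral_add (T.integrableOn_mul_polyEval (hf K) _)
      (T.integrableOn_mul_polyEval (hf K) _)]
    have e1 : (u + v).1.1 K = u.1.1 K + v.1.1 K := rfl
    simp only [e1, polyEval_add, mul_add]
  map_smul' c v := by
    unfold primalLoad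
    rw [RingHom.id_apply, smul_eq_mul, Finset.mul_sum]
    refine Finset.sum_congr rfl fun K _ => ?_
    have e1 : (c • v).1.1 K = c • v.1.1 K := rfl
    rw [← integral_const_mul]
    simp only [e1, polyEval_smul, mul_left_comm]

/-- Definiteness of the form: the gradients and the projected jumps vanish element by element, so
that the scalar variable is constant on elements and agrees with the single-valued trace variable;
the boundary condition then propagates through the mesh. -/
theorem eq_zero_of_primalForm_self_eq_zero (hd : 1 ≤ d) (hΩ : IsOpen Ω) {a : T.Cell → ℝ}
    (ha : ∀ K, 0 < a K) {k m : ℕ} (hk : 1 ≤ k) (hm : k - 1 ≤ m) {γ : ℝ}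
    (hγ : (k : ℝ) * ((k : ℝ) + (d : ℝ) - 1) / (d : ℝ) < γ) (u : T.V k × T.M0 m)
    (hu : T.primalForm a (T.stabPrimal a γ) u u = 0) : u = 0 := by
  have hdeg : ∀ K, (u.1.1 K).totalDegree ≤ k := fun K =>
    (MvPolynomial.mem_restrictTotalDegree _ _ _).1 (Submodule.mem_pi.1 u.1.2 K trivial)
  have hhat : ∀ F, u.2.1 F ∈ T.facetPoly m F := fun F => Submodule.mem_pi.1 u.2.2.1 F trivial
  set w : T.Cell → (F : T.Facet) → T.FacetL2 F :=
    fun K F => T.proj m F (T.trace F (u.1.1 K)) - u.2.1 F with hw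
  set g : T.Cell → (F : T.Facet) → T.FacetL2 F :=
    fun K F => T.trace F (polyDirDeriv (T.outwardNormal K F) (u.1.1 K)) with hg
  -- normal derivatives have degree at most `m`, so they only see the projected jump
  have hgw : ∀ K F, inner ℝ (a K • g K F) (T.trace F (u.1.1 K) - u.2.1 F) =
      inner ℝ (a K • g K F) (w K F) := by
    intro K F
    have hgm : a K • g K F ∈ T.facetPoly m F := by
      refine Submodule.smul_mem _ _ (Submodule.mem_map_of_mem ?_)
      rw [MvPolynomial.mem_restrictTotalDegree]
      exact (totalDegree_polyDirDeriv_le _ _).trans ((Nat.sub_le_sub_right (hdeg K) 1).trans hm)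
    have h1 : (T.facetPoly m F).starProjection (a K • g K F) = a K • g K F :=
      Submodule.starProjection_eq_self_iff.2 hgm
    have h2 : (T.facetPoly m F).starProjection (u.2.1 F) = u.2.1 F :=
      Submodule.starProjection_eq_self_iff.2 (hhat F)
    rw [← h1, Submodule.inner_starProjection_left_eq_right, map_sub, h2, h1]
    rfl
  have hd' : (1 : ℝ) ≤ d := by exact_mod_cast hd
  have hk' : (1 : ℝ) ≤ k := by exact_mod_cast hk
  have hCpos : 0 < (k : ℝ) * ((k : ℝ) + (d : ℝ) - 1) / (d : ℝ) :=
    div_pos (mul_pos (by linarith) (by linarith)) (by linarith)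
  set G : T.Cell → ℝ := fun K => ∫ x in hull K.1, ‖polyGrad (u.1.1 K) x‖ ^ 2 with hGdef
  have hcell := fun K : T.Cell => element_form_coercive (T.facetsOf K) (T.facetsOf_nonempty K)
    T.facetArea (fun F hF => (T.facetMeasure_sharp_trace hd hF).1) (ha K) hCpos hγ
    (vol := T.cellVolume K) (measureReal_hull_pos K.1 (T.card_cell _ K.2)
      (T.affineIndependent _ K.2)) (G := G K) (integral_nonneg fun x => sq_nonneg _) (g K) (w K)
    (fun F hF => T.norm_trace_polyDirDeriv_sq_le hd hk hF (T.norm_outwardNormal_le K F) (hdeg K))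
  have hform : T.primalForm a (T.stabPrimal a γ) u u = ∑ K : T.Cell, (a K * G K -
      2 * ∑ F ∈ T.facetsOf K, inner ℝ (a K • g K F) (w K F) +
      ∑ F ∈ T.facetsOf K, inner ℝ ((a K * γ / T.facetArea F *
        ∑ F' ∈ T.facetsOf K, T.facetArea F' ^ 2 / T.cellVolume K) • w K F) (w K F)) := by
    unfold primalForm
    refine Finset.sum_congr rfl fun K _ => ?_
    have h1 : ∫ x in hull K.1, a K * inner ℝ (polyGrad (u.1.1 K) x) (polyGrad (u.1.1 K) x) =
        a K * G K := by
      rw [integral_const_mul]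
      simp only [real_inner_self_eq_norm_sq, hGdef]
    have h2 : ∑ F ∈ T.facetsOf K, inner ℝ (a K • T.trace F (polyDirDeriv (T.outwardNormal K F)
        (u.1.1 K))) (T.trace F (u.1.1 K) - u.2.1 F) =
        ∑ F ∈ T.facetsOf K, inner ℝ (a K • g K F) (w K F) :=
      Finset.sum_congr rfl fun F _ => hgw K F
    rw [h1, h2]
    simp only [stabPrimal, hw]
    ring
  rw [hform] at hu
  have hzero : ∀ K, G K = 0 ∧ ∀ F ∈ T.facetsOf K, w K F = 0 := fun K =>
    (hcell K).2 ((Finset.sum_eq_zero_iff_of_nonneg fun K _ => (hcell K).1).1 hu K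
      (Finset.mem_univ K))
  have hconst : ∀ K, u.1.1 K = MvPolynomial.C ((u.1.1 K).coeff 0) := fun K =>
    eq_C_of_integral_norm_polyGrad_eq_zero (T.card_cell _ K.2) (T.affineIndependent _ K.2)
      (hzero K).1
  set c : T.Cell → ℝ := fun K => (u.1.1 K).coeff 0 with hc
  have hmemK : ∀ {K : T.Cell} {F : T.Facet}, F.1 ⊆ K.1 → F ∈ T.facetsOf K := fun h => by
    simpa [facetsOf] using h
  have htr : ∀ (K : T.Cell) (F : T.Facet), F.1 ⊆ K.1 →
      T.trace F (MvPolynomial.C (c K)) = u.2.1 F := by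
    intro K F hF
    have h1 := (hzero K).2 F (hmemK hF)
    simp only [hw, sub_eq_zero] at h1
    rw [← h1, hconst K]
    refine (Submodule.starProjection_eq_self_iff.2 (Submodule.mem_map_of_mem ?_)).symm
    rw [MvPolynomial.mem_restrictTotalDegree, MvPolynomial.totalDegree_C]
    exact Nat.zero_le _
  have htr0 : ∀ (K : T.Cell) (F : T.Facet) (r : ℝ), F.1 ⊆ K.1 →
      T.trace F (MvPolynomial.C r) = 0 → r = 0 := by
    intro K F r hF h
    have h1 := T.norm_trace_C_sq F r
    rw [h, norm_zero, zero_pow two_ne_zero] at h1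
    have hpos := (T.facetMeasure_sharp_trace hd (hmemK hF)).1
    simpa [hpos.ne'] using h1.symm
  have hc0 : ∀ K, c K = 0 := fun K => not_not.1 <|
    T.not_of_facet_neighbours hd hΩ (fun K => c K ≠ 0) (fun K K' F hF hF' h h' => h (by
      have h1 : T.trace F (MvPolynomial.C (c K)) = 0 := by
        rw [htr K F hF, ← htr K' F hF', h', map_zero, map_zero]
      exact htr0 K F _ hF h1))
      (fun K F hF hb h => h (htr0 K F _ hF (by
        rw [htr K F hF]
        exact (Submodule.mem_bot ℝ).1 (Submodule.mem_pi.1 u.2.2.2 F hb)))) K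
  refine Prod.ext (Subtype.ext (funext fun K => ?_)) (Subtype.ext (funext fun F => ?_))
  · rw [hconst K]
    change MvPolynomial.C (c K) = 0
    rw [hc0, map_zero]
  · obtain ⟨K, hK, hFK⟩ : ∃ K ∈ T.cells, F.1 ⊆ K := by
      have := F.2
      simp only [facets, Finset.mem_biUnion, Finset.mem_powersetCard] at this
      obtain ⟨K, hK, hFK, -⟩ := this
      exact ⟨K, hK, hFK⟩
    rw [← htr ⟨K, hK⟩ F hFK, hc0, map_zero, map_zero]
    rfl

end Mesh

end HDG

theorem mainTheorem3 (d : ℕ) (hd : d = 2 ∨ d = 3)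
    (Ω : Set (HDG.Space d)) (hΩ : IsOpen Ω) (hΩ' : IsConnected Ω) (T : HDG.Mesh d Ω)
    (a : T.Cell → ℝ) (ha : ∀ K, 0 < a K)
    (f : HDG.Space d → ℝ) (hf : MemLp f 2 (volume.restrict Ω))
    (k δ : ℕ) (hk : 1 ≤ k) (hδ : δ = 0 ∨ δ = 1)
    (γ : ℝ) (hγ : (k : ℝ) * ((k : ℝ) + (d : ℝ) - 1) / (d : ℝ) < γ) :
    ∃! u : T.V k × T.M0 (k - δ), ∀ v : T.V k × T.M0 (k - δ),
      T.primalForm a (T.stabPrimal a γ) u v = T.primalLoad f v := by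
  have hd1 : 1 ≤ d := by omega
  set B := T.primalBilin a (T.stabPrimal a γ) (k := k) (m := k - δ) with hB
  have hinj : Function.Injective B := by
    rw [← LinearMap.ker_eq_bot, LinearMap.ker_eq_bot']
    intro u hu
    exact T.eq_zero_of_primalForm_self_eq_zero hd1 hΩ ha hk (by omega) hγ u
      (LinearMap.congr_fun hu u)
  have hsurj : Function.Surjective B :=
    (LinearMap.injective_iff_surjective_of_finrank_eq_finrank
      (Subspace.dual_finrank_eq (K := ℝ)).symm).1 hinj
  obtain ⟨u, hu⟩ := hsurj (T.primalLoadLinear fun K => T.memLp_hull hf K)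
  refine ⟨u, fun v => LinearMap.congr_fun hu v, fun u' hu' => hinj ?_⟩
  rw [hu]
  exact LinearMap.ext hu'
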